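/- **Theorem (Convergence rate of DProxSGT).** Let $n\ge 1$, $d\ge 0$, and let $\phi=\frac1n\sum_{i=1}^n f_i+r$ on $\mathbb{R}^d$, where $f_i(x)=\mathbb{E}_{\xi_i\sim\mathcal D_i}[F_i(x,\xi_i)]$ and $r:\mathbb{R}^d\to(-\infty,+\infty]$ has domain $\mathrm{dom}(r)=\{r<+\infty\}$. Assume: 1. $r$ is closed and convex; for some $L>0$ each $f_i$ (well defined near $\mathrm{dom}(r)$) is differentiable at every point of $\mathrm{dom}(r)$ with $\|\nabla f_i(x)-\nabla f_i(y)\|\le L\|x-y\|$ for all $x,y\in\mathrm{dom}(r)$; and $\phi$ is bounded below. 2. $W\in\mathbb{R}^{n\times n}$ is doubly stochastic (nonnegative entries, $W\mathbf 1=\mathbf 1$, $\mathbf 1^\top W=\mathbf 1^\top$) and $\rho:=\|W-J\|_2<1$, where $J=\frac1n\mathbf 1\mathbf 1^\top$ and $\|\cdot\|_2$ is the spectral norm. 3. The samples $\xi_i^t\sim\mathcal D_i$ ($1\le i\le n$, $t\ge0$) are independent, and for some $\sigma\ge0$, all $i$ and all $x\in\mathrm{dom}(r)$, the stochastic gradient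 $\nabla F_i(x,\xi_i)$ (the gradient in $x$, which for each such $x$ exists almost surely and is set to $0$ where it does not exist) satisfies $\mathbb{E}_{\xi_i}[\nabla F_i(x,\xi_i)]=\nabla f_i(x)$ and $\mathbb{E}_{\xi_i}\|\nabla F_i(x,\xi_i)-\nabla f_i(x)\|^2\le\sigma^2$. The map $(x,\xi)\mapsto\nabla F_i(x,\xi)$ is measurable on $\mathrm{dom}(r)$ times the sample space. For a matrix $X=[x_1,\dots,x_n]\in\mathbb{R}^{d\times n}$ put $X_\perp=X(I-J)$ and let $\|X\|$ be its Frobenius norm. For $\lambda>0$ and $\psi:\mathbb{R}^d\to(-\infty,+\infty]$ let $\psi_\lambda(x)=\inf_y\{\psi(y)+\frac1{2\lambda}\|y-x\|^2\}$ be the Moreau envelope and let $\mathrm{prox}_{\lambda\psi}(x)$ be the minimizer in this problem. Let $$\lambda=\min\Big\{\frac1{4L},\frac1{96\rho L}\Big\},\qquad 0<\eta\le\min\Big\{\frac1{4L},\frac{(1-\rho^2)^4}{96\rho L}\Big\},$$ where the terms with $\rho$ in the denominator are read as $+\infty$ if $\rho=0$. DProxSGT starts from $x_i^0=x^0\in\mathrm{dom}(r)$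 for all $i$, with $y_i^{-1}=0$ and $\nabla F_i(x_i^{-1},\xi_i^{-1}):=0$, and performs for $t=0,1,2,\dots$ and all $i$ $$y_i^{t-\frac12}=y_i^{t-1}+\nabla F_i(x_i^t,\xi_i^t)-\nabla F_i(x_i^{t-1},\xi_i^{t-1}),\quad y_i^t=\sum_{j=1}^n W_{ji}\,y_j^{t-\frac12},$$ $$x_i^{t+\frac12}=\mathrm{prox}_{\eta r}(x_i^t-\eta y_i^t),\quad x_i^{t+1}=\sum_{j=1}^n W_{ji}\,x_j^{t+\frac12}.$$ Let $X^t=[x_1^t,\dots,x_n^t]$ and $\nabla\mathbf F^0=[\nabla F_1(x^0,\xi_1^0),\dots,\nabla F_n(x^0,\xi_n^0)]$. Let $T\ge1$, and let $\tau$ be uniform on $\{0,\dots,T-1\}$ and independent of all samples. Then $\phi_\lambda$ is finite, differentiable and bounded below on $\mathbb{R}^d$ (and attains its infimum if $\phi$ does), the expectation on the left below is finite, and with $\phi_\lambda^*:=\inf_x\phi_\lambda(x)>-\infty$, $$\frac1n\,\mathbb{E}\Big[\sum_{i=1}^n\|\nabla\phi_\lambda(x_i^\tau)\|^2+\frac4{\lambda\eta}\|X_\perp^\tau\|^2\Big]\le\frac{8(\phi_\lambda(x^0)-\phi_\lambda^*)}{\eta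 T}+\frac{4616\,\eta}{\lambda(1-\rho^2)^3}\sigma^2+\frac{768\,\eta\,\mathbb{E}\big[\|\nabla\mathbf F^0(I-J)\|^2\big]}{n\lambda T(1-\rho^2)^3}.$$ -/

import Mathlib

open MeasureTheory ProbabilityTheory

namespace DProxSGT

/-- The Euclidean space `ℝ^d`. -/
abbrev Vec (d : ℕ) : Type := EuclideanSpace ℝ (Fin d)

/-- A matrix in `ℝ^{d × n}`, given by its `n` columns. -/
abbrev Cols (d n : ℕ) : Type := Fin n → Vec d

section ExtendedReal

variable {d : ℕ}

/-- The effective domain of an extended-real-valued function. -/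
def effDom (r : Vec d → EReal) : Set (Vec d) := {x | r x ≠ ⊤}

/-- The epigraph of an extended-real-valued function. -/
def epi (r : Vec d → EReal) : Set (Vec d × ℝ) := {p | r p.1 ≤ (p.2 : EReal)}

/-- A closed convex function with values in `(-∞, +∞]`: its epigraph is closed and convex. -/
structure IsClosedConvex (r : Vec d → EReal) : Prop where
  ne_bot : ∀ x, r x ≠ ⊥
  closed : IsClosed (epi r)
  convex : Convex ℝ (epi r)

/-- The function `y ↦ ψ(y) + ‖y - x‖² / (2 lam)`. -/
noncomputable def proxObj (ψ : Vec d → EReal) (lam : ℝ) (x y : Vec d) : EReal :=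
  ψ y + ((1 / (2 * lam) * ‖y - x‖ ^ 2 : ℝ) : EReal)

/-- The proximal mapping `prox_{lam ψ}(x)`: a minimizer of `proxObj ψ lam x`
(an arbitrary point if there is no minimizer). -/
noncomputable def prox (ψ : Vec d → EReal) (lam : ℝ) (x : Vec d) : Vec d :=
  Classical.epsilon fun y => ∀ z, proxObj ψ lam x y ≤ proxObj ψ lam x z

/-- The Moreau envelope as an extended real. -/
noncomputable def moreauE (ψ : Vec d → EReal) (lam : ℝ) (x : Vec d) : EReal :=
  ⨅ y, proxObj ψ lam x y

/-- The Moreau envelope as a real-valued function. -/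
noncomputable def moreau (ψ : Vec d → EReal) (lam : ℝ) (x : Vec d) : ℝ :=
  (moreauE ψ lam x).toReal

end ExtendedReal

section Matrices

variable {d n : ℕ}

/-- The product `X A` of the `d × n` matrix `X` with the `n × n` matrix `A`, by columns. -/
noncomputable def mulCols (X : Cols d n) (A : Matrix (Fin n) (Fin n) ℝ) : Cols d n :=
  fun i => ∑ j, A j i • X j

/-- The squared Frobenius norm. -/
noncomputable def frobSq (X : Cols d n) : ℝ := ∑ i, ‖X i‖ ^ 2

/-- The averaging matrix `J = 1 1ᵀ / n`. -/
noncomputable def avgMat (n : ℕ) : Matrix (Fin n) (Fin n) ℝ := Matrix.of fun _ _ => 1 / (n : ℝ)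

/-- `X_⊥ = X (I - J)`. -/
noncomputable def perp (X : Cols d n) : Cols d n := mulCols X (1 - avgMat n)

/-- The spectral norm. -/
noncomputable def specNorm (A : Matrix (Fin n) (Fin n) ℝ) : ℝ :=
  ‖Matrix.toEuclideanCLM (n := Fin n) (𝕜 := ℝ) A‖

end Matrices

section Problem

variable {d n : ℕ} {Ξ : Fin n → Type*}

/-- The local loss `f_i(x) = E_{ξ ∼ D_i} F_i(x, ξ)`. -/
noncomputable def localLoss [∀ i, MeasurableSpace (Ξ i)] (F : ∀ i, Vec d → Ξ i → ℝ)
    (D : ∀ i, Measure (Ξ i)) (i : Fin n) (x : Vec d) : ℝ := ∫ s, F i x s ∂(D i)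

/-- The stochastic gradient `∇F_i(x, s)`, with respect to `x`. -/
noncomputable def stochGrad (F : ∀ i, Vec d → Ξ i → ℝ) (i : Fin n) (x : Vec d) (s : Ξ i) : Vec d :=
  gradient (fun z => F i z s) x

/-- The objective `φ = (1/n) ∑ f_i + r`. -/
noncomputable def objective (f : Fin n → Vec d → ℝ) (r : Vec d → EReal) (x : Vec d) : EReal :=
  ((1 / (n : ℝ) * ∑ i, f i x : ℝ) : EReal) + r x

/-- The state at the beginning of iteration `t`: the columns `x_i^t`, `y_i^{t-1}` and
`∇F_i(x_i^{t-1}, ξ_i^{t-1})`. -/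
structure State (d n : ℕ) where
  x : Cols d n
  y : Cols d n
  g : Cols d n

/-- One iteration of DProxSGT, with the samples `s i` at the nodes `i`. -/
noncomputable def step (F : ∀ i, Vec d → Ξ i → ℝ) (r : Vec d → EReal)
    (W : Matrix (Fin n) (Fin n) ℝ) (η : ℝ) (S : State d n) (s : ∀ i, Ξ i) : State d n :=
  let g : Cols d n := fun i => stochGrad F i (S.x i) (s i)
  let yHalf : Cols d n := fun i => S.y i + g i - S.g i
  let y : Cols d n := mulCols yHalf W
  let xHalf : Cols d n := fun i => prox r η (S.x i - η • y i)
  { x := mulCols xHalf W, y := y, g := g }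

/-- The states of DProxSGT along the sample path `s`, from the common starting point `x0`. -/
noncomputable def run (F : ∀ i, Vec d → Ξ i → ℝ) (r : Vec d → EReal)
    (W : Matrix (Fin n) (Fin n) ℝ) (η : ℝ) (x0 : Vec d) (s : ∀ i, ℕ → Ξ i) : ℕ → State d n
  | 0 => { x := fun _ => x0, y := 0, g := 0 }
  | t + 1 => step F r W η (run F r W η x0 s t) (fun i => s i t)

/-- The iterate `X^t` of DProxSGT along the sample path `s`. -/
noncomputable def iterate (F : ∀ i, Vec d → Ξ i → ℝ) (r : Vec d → EReal)
    (W : Matrix (Fin n) (Fin n) ℝ) (η : ℝ) (x0 : Vec d) (s : ∀ i, ℕ → Ξ i) (t : ℕ) : Cols d n :=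
  (run F r W η x0 s t).x

end Problem

/-- `min {1/(4L), 1/(96 ρ L)}`, where the second term is `+∞` if `ρ = 0`. -/
noncomputable def lamChoice (L ρ : ℝ) : ℝ :=
  if ρ = 0 then 1 / (4 * L) else min (1 / (4 * L)) (1 / (96 * ρ * L))

/-- `min {1/(4L), (1-ρ²)⁴/(96 ρ L)}`, where the second term is `+∞` if `ρ = 0`. -/
noncomputable def etaMax (L ρ : ℝ) : ℝ :=
  if ρ = 0 then 1 / (4 * L) else min (1 / (4 * L)) ((1 - ρ ^ 2) ^ 4 / (96 * ρ * L))

end DProxSGT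

/-! The Moreau envelope of `φ` serves as a Lyapunov function. Since each `f i` has an `L`-Lipschitz
gradient on the domain, `φ` is `L`-weakly convex, and `lam * L ≤ 1/4` makes its proximal map `P`
well defined and Lipschitz. The envelope then has gradient `(x - P x) / lam`
(`hasGradientAt_proxValue`), so stationarity is measured by the distances `‖x i - P (x i)‖`.

Descent in one iteration combines two facts. The mixture of the points `P (x j)` is a test point for
the envelope after mixing, at the price of a Jensen error governed by the consensus error
(`sum_proxValue_mulCols_le`). Moreover `P x` is also a proximal gradient point for the step `η`, so
nonexpansiveness bounds the distance of the new points to `P (x i)` by a contraction of the old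
distance plus consensus errors and noise (`sum_norm_prox_sub_sq_le`). Gradient tracking enters here:
the average of the tracked directions is exactly the average of the current stochastic gradients.

The consensus errors of the iterates and of the tracked directions contract because `W - avgMat n`
has spectral norm below one. The tracking error is split into a predictable part and the current
noise. Every pairing of the noise with a quantity built from earlier samples has mean zero, because
each sample is independent of all the others (`integral_inner_noise`); only the squared noise
survives.

In expectation this leaves a scalar system in which descent feeds on the tracking error, and the
tracking error on the increments of the iterates, hence again on the stationarity measure. The
bounds on `lam` and `η` make the loop gain small, so it can be absorbed after summing over the
iterations (`sum_le_of_one_step`). Averaging over the independent index `τ` turns the sum into the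
stated rate. -/

namespace DProxSGT

/-! ### Proximal points and Moreau envelopes of weakly convex functions. -/

section ProxTheory

variable {E : Type*} [NormedAddCommGroup E] [InnerProductSpace ℝ E]

/-- A function `h`, considered on the convex set `C`, that is `ω`-weakly convex and has a closed
epigraph. -/
structure IsWeaklyConvexClosed (C : Set E) (h : E → ℝ) (ω : ℝ) : Prop where
  nonempty : C.Nonempty
  convex : Convex ℝ C
  closed : IsClosed {p : E × ℝ | p.1 ∈ C ∧ h p.1 ≤ p.2}
  le : ∀ x ∈ C, ∀ y ∈ C, ∀ t : ℝ, 0 ≤ t → t ≤ 1 →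
    h (x + t • (y - x)) ≤ (1 - t) * h x + t * h y + ω / 2 * (t * (1 - t)) * ‖y - x‖ ^ 2

/-- The point `p` minimizes `h(z) + ‖z - x‖² / (2 lam)` over `z ∈ C`. -/
def IsProx (C : Set E) (h : E → ℝ) (lam : ℝ) (x p : E) : Prop :=
  p ∈ C ∧ ∀ z ∈ C, h p + 1 / (2 * lam) * ‖p - x‖ ^ 2 ≤ h z + 1 / (2 * lam) * ‖z - x‖ ^ 2

variable {C : Set E} {h : E → ℝ} {ω lam : ℝ}

lemma norm_add_smul_sub_sq (x y z : E) (t : ℝ) :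
    ‖x + t • (y - x) - z‖ ^ 2 =
      (1 - t) * ‖x - z‖ ^ 2 + t * ‖y - z‖ ^ 2 - t * (1 - t) * ‖y - x‖ ^ 2 := by
  have e1 : x + t • (y - x) - z = (x - z) + t • (y - x) := by abel
  have e2 : y - z = (x - z) + (y - x) := by abel
  rw [e1, e2, norm_add_sq_real, norm_add_sq_real, inner_smul_right, norm_smul, mul_pow,
    Real.norm_eq_abs, sq_abs]
  ring

lemma IsWeaklyConvexClosed.segment_mem (H : IsWeaklyConvexClosed C h ω) {x y : E} (hx : x ∈ C)
    (hy : y ∈ C) {t : ℝ} (h0 : 0 ≤ t) (h1 : t ≤ 1) : x + t • (y - x) ∈ C :=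
  H.convex.add_smul_sub_mem hx hy ⟨h0, h1⟩

/-- A minimizing sequence of a strongly convex function converges to a minimizer. -/
theorem IsWeaklyConvexClosed.exists_isProx [CompleteSpace E] (H : IsWeaklyConvexClosed C h ω)
    (hω : lam * ω < 1) (hlam : 0 < lam) (x : E)
    (hb : ∃ m, ∀ z ∈ C, m ≤ h z + 1 / (2 * lam) * ‖z - x‖ ^ 2) : ∃ p, IsProx C h lam x p := by
  set k : E → ℝ := fun z => h z + 1 / (2 * lam) * ‖z - x‖ ^ 2 with hk
  have hγ : 0 < 1 / lam - ω := by
    rw [sub_pos, lt_div_iff₀ hlam]; linarith [mul_comm lam ω]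
  set γ := 1 / lam - ω with hγdef
  have hne : (k '' C).Nonempty := H.nonempty.image k
  have hbd : BddBelow (k '' C) := by
    obtain ⟨m, hm⟩ := hb
    exact ⟨m, by rintro _ ⟨z, hz, rfl⟩; exact hm z hz⟩
  set I := sInf (k '' C) with hI
  have hIle : ∀ z ∈ C, I ≤ k z := fun z hz => csInf_le hbd ⟨z, hz, rfl⟩
  have hseq : ∀ j : ℕ, ∃ z ∈ C, k z < I + 1 / ((j : ℝ) + 1) := by
    intro j
    obtain ⟨_, ⟨z, hz, rfl⟩, hlt⟩ := exists_lt_of_csInf_lt hne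
      (show I < I + 1 / ((j : ℝ) + 1) by have : (0:ℝ) < 1 / ((j : ℝ) + 1) := by positivity
                                         linarith)
    exact ⟨z, hz, hlt⟩
  choose y hyC hyk using hseq
  -- `k` is `γ`-strongly convex and its midpoint value is at least `I`, so two near-minimizers are
  -- close to each other.
  have key : ∀ a ∈ C, ∀ b ∈ C, γ / 8 * ‖b - a‖ ^ 2 ≤ (k a + k b) / 2 - I := by
    intro a ha b hb
    have hm := hIle _ (H.segment_mem ha hb (t := 1 / 2) (by norm_num) (by norm_num))
    have h2 := H.le a ha b hb (1 / 2) (by norm_num) (by norm_num)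
    simp only [hk] at hm ⊢
    rw [norm_add_smul_sub_sq] at hm
    have : γ / 8 * ‖b - a‖ ^ 2 = 1 / (2 * lam) * (1 / 4) * ‖b - a‖ ^ 2
        - ω / 2 * (1 / 4) * ‖b - a‖ ^ 2 := by
      rw [hγdef]; field_simp; ring
    rw [this]
    linarith
  have hone : Filter.Tendsto (fun j : ℕ => 1 / ((j : ℝ) + 1)) Filter.atTop (nhds 0) :=
    tendsto_one_div_add_atTop_nhds_zero_nat
  have hcau : CauchySeq y := by
    refine cauchySeq_of_le_tendsto_0 (fun j : ℕ => Real.sqrt (8 / γ * (1 / ((j : ℝ) + 1)))) ?_ ?_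
    · intro a b N hNa hNb
      rw [dist_comm, dist_eq_norm]
      apply Real.le_sqrt_of_sq_le
      have h1 := key _ (hyC a) _ (hyC b)
      have ha : 1 / ((a : ℝ) + 1) ≤ 1 / ((N : ℝ) + 1) := by gcongr
      have hb : 1 / ((b : ℝ) + 1) ≤ 1 / ((N : ℝ) + 1) := by gcongr
      have h3 : γ / 8 * ‖y b - y a‖ ^ 2 ≤ 1 / ((N : ℝ) + 1) := by
        linarith [hyk a, hyk b]
      calc ‖y b - y a‖ ^ 2 = 8 / γ * (γ / 8 * ‖y b - y a‖ ^ 2) := by field_simp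
        _ ≤ _ := by gcongr
    · have := (Real.continuous_sqrt.tendsto 0).comp
        (by simpa using hone.const_mul (8 / γ) :
          Filter.Tendsto (fun j : ℕ => 8 / γ * (1 / ((j : ℝ) + 1))) Filter.atTop (nhds 0))
      simpa [Function.comp_def] using this
  obtain ⟨p, hp⟩ := cauchySeq_tendsto_of_complete hcau
  have hn : Filter.Tendsto (fun j => 1 / (2 * lam) * ‖y j - x‖ ^ 2) Filter.atTop
      (nhds (1 / (2 * lam) * ‖p - x‖ ^ 2)) := ((hp.sub_const x).norm.pow 2).const_mul _
  -- Lower semicontinuity of `h` is available only through its closed epigraph: these pairs lie in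
  -- it and converge.
  have hlim : Filter.Tendsto
      (fun j => (y j, I + 1 / ((j : ℝ) + 1) - 1 / (2 * lam) * ‖y j - x‖ ^ 2)) Filter.atTop
      (nhds (p, I - 1 / (2 * lam) * ‖p - x‖ ^ 2)) := by
    have := ((hone.const_add I).sub hn)
    rw [add_zero] at this
    exact hp.prodMk_nhds this
  have hmem := H.closed.mem_of_tendsto hlim (Filter.Eventually.of_forall fun j =>
    (⟨hyC j, by have := hyk j; simp only [hk] at this; dsimp only; linarith⟩ :
      _ ∈ {p : E × ℝ | p.1 ∈ C ∧ h p.1 ≤ p.2}))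
  refine ⟨p, hmem.1, fun z hz => ?_⟩
  have := hIle z hz
  have h2 := hmem.2
  simp only [hk] at this
  dsimp only at h2
  linarith

/-- A subgradient inequality that holds up to some quadratic error holds with the error given by
weak convexity. -/
theorem IsWeaklyConvexClosed.subgradient_of_quadratic (H : IsWeaklyConvexClosed C h ω) {p v : E}
    {K : ℝ} (hp : p ∈ C)
    (hK : ∀ z ∈ C, h p + inner ℝ v (z - p) - K * ‖z - p‖ ^ 2 ≤ h z) {z : E} (hz : z ∈ C) :
    h p + inner ℝ v (z - p) - ω / 2 * ‖z - p‖ ^ 2 ≤ h z := by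
  -- The hypothesis is used at `p + t • (z - p)` and divided by `t`. The `K` term keeps a factor `t`
  -- and disappears as `t → 0`, while the weak convexity term survives.
  have key : ∀ t : ℝ, 0 < t → t ≤ 1 →
      h p + inner ℝ v (z - p) - ω / 2 * (1 - t) * ‖z - p‖ ^ 2 - K * t * ‖z - p‖ ^ 2 ≤ h z := by
    intro t h0 h1
    have a := hK _ (H.segment_mem hp hz h0.le h1)
    have b := H.le p hp z hz t h0.le h1
    rw [add_sub_cancel_left, inner_smul_right, norm_smul, mul_pow, Real.norm_eq_abs, sq_abs] at a
    have : t * (h p + inner ℝ v (z - p) - ω / 2 * (1 - t) * ‖z - p‖ ^ 2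
        - K * t * ‖z - p‖ ^ 2) ≤ t * h z := by linarith
    exact le_of_mul_le_mul_left this h0
  have hc : Continuous fun t : ℝ =>
      h p + inner ℝ v (z - p) - ω / 2 * (1 - t) * ‖z - p‖ ^ 2 - K * t * ‖z - p‖ ^ 2 := by
    fun_prop
  have hl := (hc.tendsto 0).mono_left (nhdsWithin_le_nhds (s := Set.Ioi 0))
  have := le_of_tendsto hl (by
    filter_upwards [Ioc_mem_nhdsGT (zero_lt_one (α := ℝ))] with t ht using key t ht.1 ht.2)
  simpa using this

lemma prox_expand (x p z : E) :
    1 / (2 * lam) * ‖p - x‖ ^ 2 - 1 / (2 * lam) * ‖z - x‖ ^ 2 =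
      inner ℝ ((1 / lam) • (x - p)) (z - p) - 1 / (2 * lam) * ‖z - p‖ ^ 2 := by
  have e : z - x = (z - p) - (x - p) := by abel
  rw [e, norm_sub_sq_real (z - p), norm_sub_rev p x, inner_smul_left, real_inner_comm]
  simp only [conj_trivial]
  ring

/-- Expanding the squares turns minimality into a subgradient inequality with error constant `1 / (2
* lam)`, which `subgradient_of_quadratic` improves to `ω / 2`. -/
theorem IsProx.variational (H : IsWeaklyConvexClosed C h ω) {x p : E} (hp : IsProx C h lam x p)
    {z : E} (hz : z ∈ C) :
    h p + inner ℝ ((1 / lam) • (x - p)) (z - p) - ω / 2 * ‖z - p‖ ^ 2 ≤ h z := by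
  refine H.subgradient_of_quadratic (K := 1 / (2 * lam)) hp.1 (fun w hw => ?_) hz
  have := hp.2 w hw
  have e := prox_expand (lam := lam) x p w
  linarith

/-- Sum of the variational inequality of `p` tested at `q` and that of `q` tested at `p`. -/
theorem IsProx.monotone (H : IsWeaklyConvexClosed C h ω) (hlam : 0 < lam) {x y p q : E}
    (hp : IsProx C h lam x p) (hq : IsProx C h lam y q) :
    (1 - lam * ω) * ‖p - q‖ ^ 2 ≤ inner ℝ (x - y) (p - q) := by
  have a := hp.variational H hq.1
  have b := hq.variational H hp.1
  rw [norm_sub_rev] at a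
  have e : inner ℝ (x - y) (p - q) = ‖p - q‖ ^ 2 - lam * (inner ℝ ((1 / lam) • (x - p)) (q - p)
      + inner ℝ ((1 / lam) • (y - q)) (p - q)) := by
    rw [inner_smul_left, inner_smul_left, ← real_inner_self_eq_norm_sq]
    simp only [conj_trivial]
    have : x - y = (p - q) + ((x - p) - (y - q)) := by abel
    rw [this, inner_add_left, inner_sub_left (x - p), ← neg_sub p q, inner_neg_right]
    field_simp
    ring
  rw [e]
  have : lam * (inner ℝ ((1 / lam) • (x - p)) (q - p)
      + inner ℝ ((1 / lam) • (y - q)) (p - q)) ≤ lam * (ω * ‖p - q‖ ^ 2) :=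
    mul_le_mul_of_nonneg_left (by linarith) hlam.le
  linarith

theorem IsProx.norm_sub_le (H : IsWeaklyConvexClosed C h ω) (hlam : 0 < lam) {x y p q : E}
    (hp : IsProx C h lam x p) (hq : IsProx C h lam y q) :
    (1 - lam * ω) * ‖p - q‖ ≤ ‖x - y‖ := by
  rcases eq_or_lt_of_le (norm_nonneg (p - q)) with h0 | h0
  · rw [← h0]; simp
  · have := (hp.monotone H hlam hq).trans (real_inner_le_norm _ _)
    refine le_of_mul_le_mul_right ?_ h0
    nlinarith

/-- After expanding the square, monotonicity leaves `‖p - q‖ ^ 2` with coefficient `1 - 2 * (1 - lam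
* ω)`, which is nonpositive exactly when `lam * ω ≤ 1 / 2`. -/
theorem IsProx.norm_residual_sub_le (H : IsWeaklyConvexClosed C h ω) (hlam : 0 < lam)
    (hω : lam * ω ≤ 1 / 2) {x y p q : E} (hp : IsProx C h lam x p) (hq : IsProx C h lam y q) :
    ‖(x - p) - (y - q)‖ ≤ ‖x - y‖ := by
  refine le_of_sq_le_sq ?_ (norm_nonneg _)
  have a := hp.monotone H hlam hq
  have e : (x - p) - (y - q) = (x - y) - (p - q) := by abel
  rw [e, norm_sub_sq_real]
  nlinarith [sq_nonneg ‖p - q‖]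

/-- The value of the proximal problem at `x` with minimizer `P x`. -/
noncomputable def proxValue (h : E → ℝ) (lam : ℝ) (P : E → E) (x : E) : ℝ :=
  h (P x) + 1 / (2 * lam) * ‖P x - x‖ ^ 2

/-- Testing the problem at `y` with `P x` gives a quadratic upper model at `x`. Exchanging `x` and
`y` gives a lower model with the residual at `y`, which the Lipschitz bound on residuals replaces by
the one at `x`. The linearization error is thus quadratic. -/
theorem hasGradientAt_proxValue [CompleteSpace E] (H : IsWeaklyConvexClosed C h ω)
    (hlam : 0 < lam) (hω : lam * ω ≤ 1 / 2) {P : E → E} (hP : ∀ x, IsProx C h lam x (P x))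
    (x : E) : HasGradientAt (proxValue h lam P) ((1 / lam) • (x - P x)) x := by
  have upper : ∀ x y, proxValue h lam P y - proxValue h lam P x
      ≤ inner ℝ ((1 / lam) • (x - P x)) (y - x) + 1 / (2 * lam) * ‖y - x‖ ^ 2 := by
    intro x y
    have := (hP y).2 (P x) (hP x).1
    have e : P x - y = (P x - x) - (y - x) := by abel
    simp only [proxValue]
    rw [e, norm_sub_sq_real (P x - x), ← neg_sub x (P x), inner_neg_left, norm_neg] at this
    rw [inner_smul_left, ← neg_sub x (P x), norm_neg]
    simp only [conj_trivial]
    have e2 : 1 / (2 * lam) * (‖x - P x‖ ^ 2 - 2 * -inner ℝ (x - P x) (y - x) + ‖y - x‖ ^ 2) =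
      1 / (2 * lam) * ‖x - P x‖ ^ 2 + 1 / lam * inner ℝ (x - P x) (y - x)
        + 1 / (2 * lam) * ‖y - x‖ ^ 2 := by field_simp; ring
    linarith
  have lower : ∀ y, inner ℝ ((1 / lam) • (x - P x)) (y - x) - 2 / lam * ‖y - x‖ ^ 2
      ≤ proxValue h lam P y - proxValue h lam P x := by
    intro y
    have a := upper y x
    have b := (hP y).norm_residual_sub_le H hlam hω (hP x)
    have c : -(1 / lam * ‖y - x‖ ^ 2) ≤
        inner ℝ ((1 / lam) • (y - P y)) (y - x) - inner ℝ ((1 / lam) • (x - P x)) (y - x) := by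
      rw [← inner_sub_left, ← smul_sub, inner_smul_left]
      simp only [conj_trivial]
      have := (abs_le.1 ((abs_real_inner_le_norm ((y - P y) - (x - P x)) (y - x)).trans
        (mul_le_mul_of_nonneg_right b (norm_nonneg _)))).1
      have h2 := mul_le_mul_of_nonneg_left this (by positivity : 0 ≤ 1 / lam)
      calc _ = 1 / lam * -(‖y - x‖ * ‖y - x‖) := by ring
        _ ≤ _ := h2
    rw [← neg_sub y x, inner_neg_right, norm_neg] at a
    have e : 2 / lam * ‖y - x‖ ^ 2 = 1 / lam * ‖y - x‖ ^ 2 + 1 / (2 * lam) * ‖y - x‖ ^ 2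
      + 1 / (2 * lam) * ‖y - x‖ ^ 2 := by field_simp; ring
    have : 0 ≤ 1 / (2 * lam) * ‖y - x‖ ^ 2 := by positivity
    linarith
  rw [hasGradientAt_iff_isLittleO]
  refine Asymptotics.IsBigO.trans_isLittleO (g := fun y => ‖y - x‖ ^ 2) ?_ ?_
  · refine Asymptotics.IsBigO.of_bound (2 / lam) (Filter.Eventually.of_forall fun y => ?_)
    rw [Real.norm_eq_abs, Real.norm_eq_abs, abs_of_nonneg (sq_nonneg ‖y - x‖), abs_le]
    have a := upper x y
    have b := lower y
    have : 1 / (2 * lam) * ‖y - x‖ ^ 2 ≤ 2 / lam * ‖y - x‖ ^ 2 := by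
      have e : 2 / lam * ‖y - x‖ ^ 2 = 1 / (2 * lam) * ‖y - x‖ ^ 2
        + 3 / (2 * lam) * ‖y - x‖ ^ 2 := by field_simp; ring
      have : 0 ≤ 3 / (2 * lam) * ‖y - x‖ ^ 2 := by positivity
      linarith
    constructor <;> linarith
  · rw [Asymptotics.isLittleO_iff]
    intro c hc
    filter_upwards [Metric.ball_mem_nhds x hc] with y hy
    rw [Metric.mem_ball, dist_eq_norm] at hy
    rw [Real.norm_eq_abs, abs_of_nonneg (sq_nonneg _), sq]
    exact mul_le_mul_of_nonneg_right hy.le (norm_nonneg _)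

/-- A function whose gradient is `L`-Lipschitz on a convex set agrees there with its linearization
up to `L/2` times the squared distance. -/
theorem abs_sub_linearization_le [CompleteSpace E] {f : E → ℝ} {L : ℝ} (hC : Convex ℝ C)
    (hd : ∀ x ∈ C, DifferentiableAt ℝ f x)
    (hL : ∀ x ∈ C, ∀ y ∈ C, ‖gradient f x - gradient f y‖ ≤ L * ‖x - y‖) {x y : E}
    (hx : x ∈ C) (hy : y ∈ C) :
    |f y - f x - inner ℝ (gradient f x) (y - x)| ≤ L / 2 * ‖y - x‖ ^ 2 := by
  have hmem : ∀ t : ℝ, 0 ≤ t → t ≤ 1 → x + t • (y - x) ∈ C := fun t h0 h1 =>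
    hC.add_smul_sub_mem hx hy ⟨h0, h1⟩
  have hder : ∀ t : ℝ, 0 ≤ t → t ≤ 1 → HasDerivAt (fun t : ℝ => f (x + t • (y - x)))
      (inner ℝ (gradient f (x + t • (y - x))) (y - x)) t := by
    intro t h0 h1
    have hg := (hd _ (hmem t h0 h1)).hasGradientAt.hasFDerivAt
    have hl : HasDerivAt (fun t : ℝ => x + t • (y - x)) (y - x) t := by
      simpa using ((hasDerivAt_id t).smul_const (y - x)).const_add x
    exact hg.comp_hasDerivAt t hl
  have hbd : ∀ t : ℝ, 0 ≤ t → t ≤ 1 →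
      |inner ℝ (gradient f (x + t • (y - x))) (y - x) - inner ℝ (gradient f x) (y - x)|
        ≤ L * t * ‖y - x‖ ^ 2 := by
    intro t h0 h1
    rw [← inner_sub_left]
    refine (abs_real_inner_le_norm _ _).trans ?_
    have := hL _ (hmem t h0 h1) _ hx
    rw [add_sub_cancel_left, norm_smul, Real.norm_eq_abs, abs_of_nonneg h0] at this
    calc _ ≤ L * (t * ‖y - x‖) * ‖y - x‖ := by gcongr
      _ = _ := by ring
  -- The sign `s` covers both bounds: the signed deviation from the linearization minus `L / 2 * ‖y
  -- - x‖ ^ 2 * t ^ 2` has nonpositive derivative along the segment.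
  have aux : ∀ s : ℝ, (s = 1 ∨ s = -1) →
      s * (f y - f x - inner ℝ (gradient f x) (y - x)) ≤ L / 2 * ‖y - x‖ ^ 2 := by
    intro s hs
    have hder2 : ∀ t : ℝ, 0 ≤ t → t ≤ 1 → HasDerivAt (fun t : ℝ => s * (f (x + t • (y - x))
        - t * inner ℝ (gradient f x) (y - x)) - L / 2 * ‖y - x‖ ^ 2 * t ^ 2)
        (s * (inner ℝ (gradient f (x + t • (y - x))) (y - x)
          - inner ℝ (gradient f x) (y - x)) - L * t * ‖y - x‖ ^ 2) t := by
      intro t h0 h1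
      have h2 := ((hder t h0 h1).sub ((hasDerivAt_id t).mul_const
        (inner ℝ (gradient f x) (y - x)))).const_mul s
      have h3 := ((hasDerivAt_id t).pow 2).const_mul (L / 2 * ‖y - x‖ ^ 2)
      exact (h2.sub h3).congr_deriv (by simp; ring)
    have hanti : AntitoneOn (fun t : ℝ => s * (f (x + t • (y - x))
        - t * inner ℝ (gradient f x) (y - x)) - L / 2 * ‖y - x‖ ^ 2 * t ^ 2)
        (Set.Icc (0 : ℝ) 1) := by
      refine antitoneOn_of_deriv_nonpos (convex_Icc 0 1)
        (fun t ht => (hder2 t ht.1 ht.2).continuousAt.continuousWithinAt)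
        (fun t ht => ?_) (fun t ht => ?_)
      · rw [interior_Icc] at ht
        exact (hder2 t ht.1.le ht.2.le).differentiableAt.differentiableWithinAt
      · rw [interior_Icc] at ht
        rw [(hder2 t ht.1.le ht.2.le).deriv]
        have := abs_le.1 (hbd t ht.1.le ht.2.le)
        rcases hs with rfl | rfl <;> linarith [this.1, this.2]
    have := hanti (Set.left_mem_Icc.2 zero_le_one) (Set.right_mem_Icc.2 zero_le_one) zero_le_one
    simp only [one_smul, zero_smul, add_zero, add_sub_cancel] at this
    linarith
  rw [abs_le]
  constructor
  · linarith [aux (-1) (Or.inr rfl)]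
  · linarith [aux 1 (Or.inl rfl)]

/-- The sum of a closed convex function `h` and of a function `f` with two-sided quadratic bounds
is weakly convex and closed. -/
theorem IsWeaklyConvexClosed.add_smooth (H : IsWeaklyConvexClosed C h 0) {f : E → ℝ} {g : E → E}
    {L : ℝ} (hcont : ∀ x ∈ C, ContinuousAt f x)
    (hfg : ∀ x ∈ C, ∀ y ∈ C, |f y - f x - inner ℝ (g x) (y - x)| ≤ L / 2 * ‖y - x‖ ^ 2) :
    IsWeaklyConvexClosed C (fun x => f x + h x) L where
  nonempty := H.nonempty
  convex := H.convex
  closed := by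
    refine IsSeqClosed.isClosed ?_
    intro u a hu ha
    obtain ⟨x0, hx0⟩ := H.nonempty
    have h1 : Filter.Tendsto (fun k => (u k).1) Filter.atTop (nhds a.1) :=
      (continuous_fst.tendsto a).comp ha
    have h2 : Filter.Tendsto (fun k => (u k).2) Filter.atTop (nhds a.2) :=
      (continuous_snd.tendsto a).comp ha
    -- Continuity of `f` at the limit is known only once the limit lies in `C`. Membership is
    -- obtained first, using the continuous quadratic minorant of `f` based at `x0`.
    have haC : a.1 ∈ C := by
      have hc : Continuous fun p : E × ℝ =>
          (p.1, p.2 - (f x0 + inner ℝ (g x0) (p.1 - x0) - L / 2 * ‖p.1 - x0‖ ^ 2)) := by fun_prop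
      have := H.closed.mem_of_tendsto ((hc.tendsto a).comp ha)
        (Filter.Eventually.of_forall fun k => by
          refine ⟨(hu k).1, ?_⟩
          have b := (abs_le.1 (hfg x0 hx0 _ (hu k).1)).1
          have c := (hu k).2
          simp only [Function.comp]
          linarith)
      exact this.1
    have := H.closed.mem_of_tendsto
      (h1.prodMk_nhds (h2.sub ((hcont _ haC).tendsto.comp h1)))
        (Filter.Eventually.of_forall fun k => by
          refine ⟨(hu k).1, ?_⟩
          have c := (hu k).2
          simp only [Function.comp]
          linarith)
    refine ⟨haC, ?_⟩
    have := this.2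
    simp only at this ⊢
    linarith
  le := by
    intro x hx y hy t h0 h1
    have hp := H.segment_mem hx hy h0 h1
    have a := H.le x hx y hy t h0 h1
    -- Both expansions of `f` are based at the intermediate point: the linear terms cancel in the
    -- convex combination, and the errors add up to `L / 2 * (t * (1 - t)) * ‖y - x‖ ^ 2`.
    have b := mul_le_mul_of_nonneg_left (abs_le.1 (hfg _ hp x hx)).1 (sub_nonneg.2 h1)
    have c := mul_le_mul_of_nonneg_left (abs_le.1 (hfg _ hp y hy)).1 h0
    have e1 : x - (x + t • (y - x)) = (-t) • (y - x) := by rw [neg_smul]; abel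
    have e2 : y - (x + t • (y - x)) = (1 - t) • (y - x) := by rw [sub_smul, one_smul]; abel
    rw [e1, inner_smul_right, norm_smul, mul_pow, Real.norm_eq_abs, sq_abs] at b
    rw [e2, inner_smul_right, norm_smul, mul_pow, Real.norm_eq_abs, sq_abs] at c
    linarith

end ProxTheory

/-! ### From extended-real-valued functions to real functions on their domain. -/

section ExtendedReal

variable {d : ℕ}

/-- An extended-real-valued function is represented on its domain `C` by a real function `h`. -/
structure Represents (ψ : Vec d → EReal) (C : Set (Vec d)) (h : Vec d → ℝ) : Prop where
  eq_coe : ∀ x ∈ C, ψ x = (h x : EReal)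
  eq_top : ∀ x ∉ C, ψ x = ⊤

variable {ψ : Vec d → EReal} {C : Set (Vec d)} {h : Vec d → ℝ} {lam : ℝ}

lemma Represents.proxObj_eq (H : Represents ψ C h) {x y : Vec d} (hy : y ∈ C) :
    proxObj ψ lam x y = ((h y + 1 / (2 * lam) * ‖y - x‖ ^ 2 : ℝ) : EReal) := by
  rw [proxObj, H.eq_coe y hy, ← EReal.coe_add]

lemma Represents.proxObj_eq_top (H : Represents ψ C h) {x y : Vec d} (hy : y ∉ C) :
    proxObj ψ lam x y = ⊤ := by
  rw [proxObj, H.eq_top y hy, EReal.top_add_coe]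

lemma Represents.isProx_iff (H : Represents ψ C h) (hC : C.Nonempty) {x p : Vec d} :
    IsProx C h lam x p ↔ ∀ z, proxObj ψ lam x p ≤ proxObj ψ lam x z := by
  constructor
  · rintro ⟨hp, hz⟩ z
    by_cases hzC : z ∈ C
    · rw [H.proxObj_eq hp, H.proxObj_eq hzC]
      exact_mod_cast hz z hzC
    · rw [H.proxObj_eq_top hzC]
      exact le_top
  · intro hz
    have hp : p ∈ C := by
      by_contra hp
      obtain ⟨z, hzC⟩ := hC
      have := hz z
      rw [H.proxObj_eq hzC, H.proxObj_eq_top hp, top_le_iff] at this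
      exact EReal.coe_ne_top _ this
    refine ⟨hp, fun z hzC => ?_⟩
    have := hz z
    rw [H.proxObj_eq hzC, H.proxObj_eq hp] at this
    exact_mod_cast this

lemma Represents.isProx_prox (H : Represents ψ C h) (hC : C.Nonempty) {x : Vec d}
    (hex : ∃ p, IsProx C h lam x p) : IsProx C h lam x (prox ψ lam x) := by
  rw [H.isProx_iff hC]
  obtain ⟨p, hp⟩ := hex
  exact Classical.epsilon_spec (p := fun y => ∀ z, proxObj ψ lam x y ≤ proxObj ψ lam x z)
    ⟨p, (H.isProx_iff hC).1 hp⟩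

lemma Represents.moreauE_eq (H : Represents ψ C h) (hC : C.Nonempty) {P : Vec d → Vec d}
    (hP : ∀ x, IsProx C h lam x (P x)) (x : Vec d) :
    moreauE ψ lam x = (proxValue h lam P x : EReal) := by
  rw [proxValue, ← H.proxObj_eq (hP x).1]
  exact le_antisymm (iInf_le _ _) (le_iInf ((H.isProx_iff hC).1 (hP x)))

lemma Represents.moreau_eq (H : Represents ψ C h) (hC : C.Nonempty) {P : Vec d → Vec d}
    (hP : ∀ x, IsProx C h lam x (P x)) : moreau ψ lam = proxValue h lam P := by
  funext x
  rw [moreau, H.moreauE_eq hC hP, EReal.toReal_coe]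

lemma IsClosedConvex.represents {r : Vec d → EReal} (hr : IsClosedConvex r) :
    Represents r (effDom r) (fun x => (r x).toReal) where
  eq_coe x hx := (EReal.coe_toReal hx (hr.ne_bot x)).symm
  eq_top x hx := by simpa [effDom] using hx

lemma IsClosedConvex.isWeaklyConvexClosed {r : Vec d → EReal} (hr : IsClosedConvex r)
    (hne : (effDom r).Nonempty) :
    IsWeaklyConvexClosed (effDom r) (fun x => (r x).toReal) 0 := by
  have hepi : ∀ x (s : ℝ), (x, s) ∈ epi r ↔ x ∈ effDom r ∧ (r x).toReal ≤ s := by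
    intro x s
    constructor
    · intro hx
      have hx' : r x ≤ (s : EReal) := hx
      have hd : x ∈ effDom r := fun htop => by
        rw [htop, top_le_iff] at hx'; exact EReal.coe_ne_top _ hx'
      refine ⟨hd, ?_⟩
      rw [hr.represents.eq_coe x hd] at hx'
      exact_mod_cast hx'
    · rintro ⟨hd, hx⟩
      change r x ≤ (s : EReal)
      rw [hr.represents.eq_coe x hd]
      exact_mod_cast hx
  have hconv : ∀ x ∈ effDom r, ∀ y ∈ effDom r, ∀ t : ℝ, 0 ≤ t → t ≤ 1 →
      (x + t • (y - x), (1 - t) * (r x).toReal + t * (r y).toReal) ∈ epi r := by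
    intro x hx y hy t h0 h1
    have := hr.convex.add_smul_sub_mem ((hepi x _).2 ⟨hx, le_rfl⟩) ((hepi y _).2 ⟨hy, le_rfl⟩)
      ⟨h0, h1⟩
    convert this using 1
    ext1
    · rfl
    · simp; ring
  refine ⟨hne, ?_, ?_, ?_⟩
  · rw [convex_iff_segment_subset]
    intro x hx y hy
    rw [segment_eq_image']
    rintro _ ⟨t, ht, rfl⟩
    exact ((hepi _ _).1 (hconv x hx y hy t ht.1 ht.2)).1
  · convert hr.closed using 1
    ext ⟨x, s⟩
    exact (hepi x s).symm
  · intro x hx y hy t h0 h1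
    have := ((hepi _ _).1 (hconv x hx y hy t h0 h1)).2
    linarith

end ExtendedReal

/-! ### Frobenius norms, consensus errors and mixing. -/

section Matrices

variable {d n : ℕ}

lemma mulCols_apply (X : Cols d n) (A : Matrix (Fin n) (Fin n) ℝ) (i : Fin n) :
    mulCols X A i = ∑ j, A j i • X j := rfl

lemma mulCols_add (X Y : Cols d n) (A : Matrix (Fin n) (Fin n) ℝ) :
    mulCols (X + Y) A = mulCols X A + mulCols Y A := by
  funext i
  simp [mulCols_apply, Finset.sum_add_distrib]

lemma mulCols_sub (X Y : Cols d n) (A : Matrix (Fin n) (Fin n) ℝ) :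
    mulCols (X - Y) A = mulCols X A - mulCols Y A := by
  funext i
  simp [mulCols_apply, smul_sub]

lemma mulCols_sub_right (X : Cols d n) (A B : Matrix (Fin n) (Fin n) ℝ) :
    mulCols X (A - B) = mulCols X A - mulCols X B := by
  funext i
  simp [mulCols_apply, sub_smul]

lemma mulCols_one (X : Cols d n) : mulCols X 1 = X := by
  funext i
  simp [mulCols_apply, Matrix.one_apply, ite_smul]

lemma mulCols_mulCols (X : Cols d n) (A B : Matrix (Fin n) (Fin n) ℝ) :
    mulCols (mulCols X A) B = mulCols X (A * B) := by
  funext i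
  simp only [mulCols_apply, Matrix.mul_apply, Finset.smul_sum, Finset.sum_smul, smul_smul]
  rw [Finset.sum_comm]
  refine Finset.sum_congr rfl fun j _ => Finset.sum_congr rfl fun k _ => ?_
  rw [mul_comm]

/-- Used to move a matrix off the noise and onto the factor that depends on earlier samples only. -/
lemma sum_inner_mulCols (X Y : Cols d n) (A : Matrix (Fin n) (Fin n) ℝ) :
    ∑ i, inner ℝ (X i) (mulCols Y A i) = ∑ i, inner ℝ (mulCols X A.transpose i) (Y i) := by
  simp only [mulCols_apply, inner_sum, sum_inner, inner_smul_right, inner_smul_left,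
    Matrix.transpose_apply, conj_trivial]
  exact Finset.sum_comm

lemma frobSq_nonneg (X : Cols d n) : 0 ≤ frobSq X := Finset.sum_nonneg fun _ _ => sq_nonneg _

lemma frobSq_add (X Y : Cols d n) :
    frobSq (X + Y) = frobSq X + 2 * ∑ i, inner ℝ (X i) (Y i) + frobSq Y := by
  simp only [frobSq, Pi.add_apply, norm_add_sq_real, Finset.sum_add_distrib, Finset.mul_sum]

lemma norm_add_sq_le_young {E : Type*} [NormedAddCommGroup E] (x y : E) {s : ℝ} (hs : 0 < s) :
    ‖x + y‖ ^ 2 ≤ (1 + s) * ‖x‖ ^ 2 + (1 + 1 / s) * ‖y‖ ^ 2 := by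
  have h1 : ‖x + y‖ ^ 2 ≤ (‖x‖ + ‖y‖) ^ 2 := by gcongr; exact norm_add_le _ _
  have h2 : 0 ≤ (s * ‖x‖ - ‖y‖) ^ 2 / s := by positivity
  have h3 : (s * ‖x‖ - ‖y‖) ^ 2 / s = s * ‖x‖ ^ 2 - 2 * ‖x‖ * ‖y‖ + 1 / s * ‖y‖ ^ 2 := by
    field_simp
    ring
  nlinarith

lemma frobSq_add_le_young (X Y : Cols d n) {s : ℝ} (hs : 0 < s) :
    frobSq (X + Y) ≤ (1 + s) * frobSq X + (1 + 1 / s) * frobSq Y := by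
  simp only [frobSq, Finset.mul_sum, ← Finset.sum_add_distrib]
  exact Finset.sum_le_sum fun i _ => norm_add_sq_le_young _ _ hs

/-- Each of the `d` rows of `X` is acted on by the transpose of `A`, which has the same spectral
norm. -/
lemma frobSq_mulCols_le (X : Cols d n) (A : Matrix (Fin n) (Fin n) ℝ) :
    frobSq (mulCols X A) ≤ specNorm A ^ 2 * frobSq X := by
  have hT : ‖Matrix.toEuclideanCLM (n := Fin n) (𝕜 := ℝ) A.transpose‖ = specNorm A := by
    have : A.transpose = star A := by
      rw [Matrix.star_eq_conjTranspose, Matrix.conjTranspose_eq_transpose_of_trivial]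
    rw [this, map_star]
    exact norm_star (E := EuclideanSpace ℝ (Fin n) →L[ℝ] EuclideanSpace ℝ (Fin n)) _
  have hrow : ∀ k : Fin d, ∑ i, (mulCols X A i k) ^ 2 ≤ specNorm A ^ 2 * ∑ i, (X i k) ^ 2 := by
    intro k
    have := (Matrix.toEuclideanCLM (n := Fin n) (𝕜 := ℝ) A.transpose).le_opNorm
      (WithLp.toLp 2 fun i => X i k)
    rw [hT] at this
    have h2 := pow_le_pow_left₀ (norm_nonneg _) this 2
    rw [mul_pow, EuclideanSpace.norm_sq_eq, EuclideanSpace.norm_sq_eq] at h2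
    simp only [Real.norm_eq_abs, sq_abs] at h2
    refine le_trans (le_of_eq ?_) h2
    refine Finset.sum_congr rfl fun i _ => ?_
    congr 1
    simp [mulCols_apply, Matrix.mulVec, dotProduct]
  simp only [frobSq, EuclideanSpace.norm_sq_eq, Real.norm_eq_abs, sq_abs]
  rw [Finset.sum_comm, Finset.sum_comm (f := fun i k => (X i k) ^ 2), Finset.mul_sum]
  exact Finset.sum_le_sum fun k _ => hrow k

/-- The average of the columns. -/
noncomputable def avgCol (X : Cols d n) : Vec d := (1 / (n : ℝ)) • ∑ j, X j

lemma perp_apply (X : Cols d n) (i : Fin n) : perp X i = X i - avgCol X := by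
  rw [perp, mulCols_sub_right, mulCols_one, Pi.sub_apply, mulCols_apply, avgCol, Finset.smul_sum]
  rfl

lemma perp_add (X Y : Cols d n) : perp (X + Y) = perp X + perp Y := mulCols_add _ _ _

lemma sum_sub_avgCol (hn : 0 < n) (X : Cols d n) : ∑ i, (X i - avgCol X) = 0 := by
  have : (n : ℝ) ≠ 0 := by positivity
  rw [Finset.sum_sub_distrib, Finset.sum_const, Finset.card_univ, Fintype.card_fin, avgCol,
    ← Nat.cast_smul_eq_nsmul ℝ, smul_smul, mul_one_div_cancel this, one_smul, sub_self]

lemma sum_perp (hn : 0 < n) (X : Cols d n) : ∑ i, perp X i = 0 := by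
  simpa only [perp_apply] using sum_sub_avgCol hn X

lemma sum_norm_sub_sq (hn : 0 < n) (X : Cols d n) (c : Vec d) :
    ∑ i, ‖X i - c‖ ^ 2 = frobSq (perp X) + n * ‖avgCol X - c‖ ^ 2 := by
  have : ∀ i, ‖X i - c‖ ^ 2 = ‖perp X i‖ ^ 2 + 2 * inner ℝ (perp X i) (avgCol X - c)
      + ‖avgCol X - c‖ ^ 2 := by
    intro i
    rw [← norm_add_sq_real, perp_apply]
    congr 2
    abel
  simp only [this, Finset.sum_add_distrib, ← Finset.mul_sum, ← sum_inner, sum_perp hn,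
    inner_zero_left, frobSq]
  simp

/-- The mean minimizes the sum of squared distances; consensus errors may therefore be estimated
from any convenient reference point. -/
lemma frobSq_perp_le_sum (hn : 0 < n) (X : Cols d n) (c : Vec d) :
    frobSq (perp X) ≤ ∑ i, ‖X i - c‖ ^ 2 := by
  rw [sum_norm_sub_sq hn]
  have : 0 ≤ n * ‖avgCol X - c‖ ^ 2 := by positivity
  linarith

lemma norm_avgCol_sq_le (hn : 0 < n) (X : Cols d n) : n * ‖avgCol X‖ ^ 2 ≤ frobSq X := by
  have := sum_norm_sub_sq hn X 0
  simp only [sub_zero] at this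
  have h2 := frobSq_nonneg (perp X)
  rw [frobSq, this]
  linarith

lemma norm_sum_smul_sq_le {ι E : Type*} [NormedAddCommGroup E] [NormedSpace ℝ E] (s : Finset ι)
    {w : ι → ℝ} (h0 : ∀ i ∈ s, 0 ≤ w i) (h1 : ∑ i ∈ s, w i = 1) (x : ι → E) :
    ‖∑ i ∈ s, w i • x i‖ ^ 2 ≤ ∑ i ∈ s, w i * ‖x i‖ ^ 2 := by
  calc ‖∑ i ∈ s, w i • x i‖ ^ 2 ≤ (∑ i ∈ s, w i * ‖x i‖) ^ 2 := by
        gcongr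
        refine (norm_sum_le _ _).trans (Finset.sum_le_sum fun i hi => ?_)
        rw [norm_smul, Real.norm_of_nonneg (h0 i hi)]
    _ ≤ _ := Real.pow_arith_mean_le_arith_mean_pow s w _ h0 h1 (fun _ _ => norm_nonneg _) 2

/-- Young's inequality with weight `s = (1 - κ) / (2 * κ)`, so that `κ * (1 + s) = (1 + κ) / 2`
gives up only half of the contraction. Keeping the factor `κ` on the left admits `κ = 0`. -/
lemma frobSq_young (X Y : Cols d n) {κ : ℝ} (h0 : 0 ≤ κ) (h1 : κ < 1) :
    κ * frobSq (X + Y) ≤ (1 + κ) / 2 * frobSq X + 2 * κ / (1 - κ) * frobSq Y := by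
  have hq : 0 < 1 - κ := by linarith
  have key : ∀ i, κ * ‖X i + Y i‖ ^ 2
      ≤ (1 + κ) / 2 * ‖X i‖ ^ 2 + 2 * κ / (1 - κ) * ‖Y i‖ ^ 2 := by
    intro i
    have a : κ * ‖X i + Y i‖ ^ 2 ≤ κ * (‖X i‖ + ‖Y i‖) ^ 2 := by gcongr; exact norm_add_le _ _
    have b : (1 + κ) / 2 * ‖X i‖ ^ 2 + 2 * κ / (1 - κ) * ‖Y i‖ ^ 2 - κ * (‖X i‖ + ‖Y i‖) ^ 2
        = ((1 - κ) * ‖X i‖ - 2 * κ * ‖Y i‖) ^ 2 / (2 * (1 - κ)) + κ * ‖Y i‖ ^ 2 := by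
      field_simp
      ring
    have c : 0 ≤ ((1 - κ) * ‖X i‖ - 2 * κ * ‖Y i‖) ^ 2 / (2 * (1 - κ)) + κ * ‖Y i‖ ^ 2 := by
      positivity
    linarith
  simp only [frobSq, Finset.mul_sum, ← Finset.sum_add_distrib]
  exact Finset.sum_le_sum fun i _ => key i

lemma frobSq_add_add_le (X Y Z : Cols d n) :
    frobSq (X + Y + Z) ≤ 3 * frobSq X + 3 * frobSq Y + 3 * frobSq Z := by
  simp only [frobSq, Finset.mul_sum, ← Finset.sum_add_distrib]
  refine Finset.sum_le_sum fun i _ => ?_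
  have h := pow_le_pow_left₀ (norm_nonneg _) (norm_add₃_le (a := X i) (b := Y i) (c := Z i)) 2
  simp only [Pi.add_apply]
  nlinarith [sq_nonneg (‖X i‖ - ‖Y i‖), sq_nonneg (‖X i‖ - ‖Z i‖), sq_nonneg (‖Y i‖ - ‖Z i‖)]

lemma frobSq_sub_le (X Y : Cols d n) : frobSq (X - Y) ≤ 2 * frobSq X + 2 * frobSq Y := by
  have := frobSq_add_le_young X (-Y) one_pos
  rw [← sub_eq_add_neg] at this
  simp only [frobSq, Pi.neg_apply, norm_neg] at this ⊢
  linarith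

variable {W : Matrix (Fin n) (Fin n) ℝ}

lemma frobSq_mulCols_doublyStochastic_le (hW : W ∈ doublyStochastic ℝ (Fin n)) (X : Cols d n) :
    frobSq (mulCols X W) ≤ frobSq X := by
  calc frobSq (mulCols X W) ≤ ∑ i, ∑ j, W j i * ‖X j‖ ^ 2 :=
        Finset.sum_le_sum fun i _ => norm_sum_smul_sq_le _
          (fun j _ => nonneg_of_mem_doublyStochastic hW)
          (sum_col_of_mem_doublyStochastic hW i) X
    _ = frobSq X := by
        rw [Finset.sum_comm]
        simp only [← Finset.sum_mul, sum_row_of_mem_doublyStochastic hW, one_mul, frobSq]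

lemma avgMat_mul (hW : W ∈ doublyStochastic ℝ (Fin n)) : avgMat n * W = avgMat n := by
  ext i j
  simp [avgMat, Matrix.mul_apply, ← Finset.mul_sum, sum_col_of_mem_doublyStochastic hW j]

lemma mul_avgMat (hW : W ∈ doublyStochastic ℝ (Fin n)) : W * avgMat n = avgMat n := by
  ext i j
  simp [avgMat, Matrix.mul_apply, ← Finset.sum_mul, sum_row_of_mem_doublyStochastic hW i]

lemma avgMat_mul_avgMat (hn : 0 < n) : avgMat n * avgMat n = avgMat n := by
  have : (n : ℝ) ≠ 0 := by positivity
  ext i j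
  simp [avgMat, Matrix.mul_apply, this]

lemma perp_mulCols (hW : W ∈ doublyStochastic ℝ (Fin n)) (X : Cols d n) :
    perp (mulCols X W) = mulCols X (W - avgMat n) := by
  rw [perp, mulCols_mulCols, mul_sub, mul_one, mul_avgMat hW]

/-- Since `avgMat n * (W - avgMat n) = 0`, the matrix `W - avgMat n` sees only the consensus error,
which mixing therefore contracts. -/
lemma mulCols_perp (hn : 0 < n) (hW : W ∈ doublyStochastic ℝ (Fin n)) (X : Cols d n) :
    mulCols (perp X) (W - avgMat n) = mulCols X (W - avgMat n) := by
  rw [perp, mulCols_mulCols, sub_mul, one_mul, mul_sub, avgMat_mul hW, avgMat_mul_avgMat hn,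
    sub_self, sub_zero]

lemma frobSq_mulCols_sub_avgMat_le (hn : 0 < n) (hW : W ∈ doublyStochastic ℝ (Fin n))
    (X : Cols d n) :
    frobSq (mulCols X (W - avgMat n)) ≤ specNorm (W - avgMat n) ^ 2 * frobSq (perp X) := by
  rw [← mulCols_perp hn hW]
  exact frobSq_mulCols_le _ _

lemma avgCol_mulCols (hW : W ∈ doublyStochastic ℝ (Fin n)) (X : Cols d n) :
    avgCol (mulCols X W) = avgCol X := by
  simp only [avgCol, mulCols_apply]
  rw [Finset.sum_comm]
  simp only [← Finset.sum_smul, sum_row_of_mem_doublyStochastic hW, one_smul]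

lemma avgCol_add (X Y : Cols d n) : avgCol (X + Y) = avgCol X + avgCol Y := by
  simp [avgCol, Finset.sum_add_distrib]

lemma avgCol_sub (X Y : Cols d n) : avgCol (X - Y) = avgCol X - avgCol Y := by
  simp [avgCol, Finset.sum_sub_distrib, smul_sub]

/-- Mixing fixes matrices with equal columns, so it displaces `X` only by an amount of the order of
its consensus error. -/
lemma mulCols_sub_self (hW : W ∈ doublyStochastic ℝ (Fin n)) (X : Cols d n) :
    mulCols X W - X = mulCols (perp X) W - perp X := by
  funext i
  simp only [Pi.sub_apply, mulCols_apply, perp_apply, smul_sub, Finset.sum_sub_distrib,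
    ← Finset.sum_smul, sum_col_of_mem_doublyStochastic hW, one_smul]
  abel

lemma mulCols_mem (hW : W ∈ doublyStochastic ℝ (Fin n)) {C : Set (Vec d)} (hC : Convex ℝ C)
    {X : Cols d n} (hX : ∀ i, X i ∈ C) (i : Fin n) : mulCols X W i ∈ C :=
  hC.sum_mem (fun _ _ => nonneg_of_mem_doublyStochastic hW)
    (sum_col_of_mem_doublyStochastic hW i) fun j _ => hX j

end Matrices

/-! ### Deterministic inequalities for one iteration. -/

section OneStep

variable {d n : ℕ}

/-- The composite problem `(1/n) ∑ f_i + h` on `C`, with `f = (1/n) ∑ f_i`, gradients `G i` of the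
`f_i`, proximal parameters `lam` for the objective and `η` for `h`, and the proximal mapping `P` of
the objective. -/
structure CompositeProblem (n : ℕ) (C : Set (Vec d)) (h f : Vec d → ℝ) (G : Fin n → Vec d → Vec d)
    (L lam η : ℝ) (P : Vec d → Vec d) : Prop where
  pos : 0 < n
  convex : IsWeaklyConvexClosed C h 0
  weaklyConvex : IsWeaklyConvexClosed C (fun x => f x + h x) L
  quadratic : ∀ x ∈ C, ∀ y ∈ C,
    |f y - f x - inner ℝ (avgCol fun i => G i x) (y - x)| ≤ L / 2 * ‖y - x‖ ^ 2
  lipschitz : ∀ i, ∀ x ∈ C, ∀ y ∈ C, ‖G i x - G i y‖ ≤ L * ‖x - y‖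
  isProx : ∀ x, IsProx C (fun x => f x + h x) lam x (P x)
  exists_prox : ∀ x, ∃ p, IsProx C h η x p
  L_nonneg : 0 ≤ L
  lam_pos : 0 < lam
  lam_mul_le : lam * L ≤ 1 / 4
  eta_pos : 0 < η
  eta_le : η ≤ lam

variable {C : Set (Vec d)} {h f : Vec d → ℝ} {G : Fin n → Vec d → Vec d} {L lam η : ℝ}
  {P : Vec d → Vec d}

/-- Jensen's inequality for the weakly convex objective. -/
lemma IsWeaklyConvexClosed.map_sum_le {E : Type*} [NormedAddCommGroup E]
    [InnerProductSpace ℝ E] {C : Set E} {φ : E → ℝ} {L : ℝ}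
    (H : IsWeaklyConvexClosed C φ L) (hL : 0 ≤ L) {ι : Type*} (s : Finset ι) {w : ι → ℝ}
    (h0 : ∀ i ∈ s, 0 ≤ w i) (h1 : ∑ i ∈ s, w i = 1) {p : ι → E} (hp : ∀ i ∈ s, p i ∈ C) (c : E) :
    φ (∑ i ∈ s, w i • p i) ≤ ∑ i ∈ s, w i * φ (p i) + L / 2 * ∑ i ∈ s, w i * ‖p i - c‖ ^ 2 := by
  -- The added square compensates the weak convexity for every centre `c`; Jensen's inequality then
  -- applies, and the square at the barycentre is dropped.
  have hconv : ConvexOn ℝ C fun x => φ x + L / 2 * ‖x - c‖ ^ 2 := by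
    refine ⟨H.convex, fun x hx y hy a b _ hb hab => ?_⟩
    obtain rfl : a = 1 - b := by linarith
    have e : (1 - b) • x + b • y = x + b • (y - x) := by rw [sub_smul, one_smul, smul_sub]; abel
    have := H.le x hx y hy b hb (by linarith)
    simp only [e, norm_add_smul_sub_sq, smul_eq_mul]
    linarith
  have := hconv.map_sum_le h0 h1 hp
  simp only [smul_eq_mul, mul_add, Finset.sum_add_distrib] at this
  have h2 : 0 ≤ L / 2 * ‖∑ i ∈ s, w i • p i - c‖ ^ 2 := by positivity
  have e : L / 2 * ∑ i ∈ s, w i * ‖p i - c‖ ^ 2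
      = ∑ i ∈ s, w i * (L / 2 * ‖p i - c‖ ^ 2) := by
    rw [Finset.mul_sum]
    exact Finset.sum_congr rfl fun _ _ => by ring
  linarith

namespace CompositeProblem

lemma norm_P_sub_le (S : CompositeProblem n C h f G L lam η P) (x y : Vec d) :
    ‖P x - P y‖ ≤ 4 / 3 * ‖x - y‖ := by
  have := (S.isProx x).norm_sub_le S.weaklyConvex S.lam_pos (S.isProx y)
  have h2 : (3 / 4) * ‖P x - P y‖ ≤ (1 - lam * L) * ‖P x - P y‖ := by
    gcongr; linarith [S.lam_mul_le]
  linarith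

lemma norm_residual_sub_le (S : CompositeProblem n C h f G L lam η P) (x y : Vec d) :
    ‖(x - P x) - (y - P y)‖ ≤ ‖x - y‖ :=
  (S.isProx x).norm_residual_sub_le S.weaklyConvex S.lam_pos (by linarith [S.lam_mul_le])
    (S.isProx y)

lemma norm_avgCol_sub_le (S : CompositeProblem n C h f G L lam η P) {x y : Vec d} (hx : x ∈ C)
    (hy : y ∈ C) : ‖avgCol (fun i => G i x) - avgCol (fun i => G i y)‖ ≤ L * ‖x - y‖ := by
  have hn : (0 : ℝ) < n := by exact_mod_cast S.pos
  rw [avgCol, avgCol, ← smul_sub, ← Finset.sum_sub_distrib, norm_smul,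
    Real.norm_of_nonneg (by positivity)]
  calc 1 / (n : ℝ) * ‖∑ i, (G i x - G i y)‖ ≤ 1 / (n : ℝ) * ∑ i : Fin n, L * ‖x - y‖ := by
        gcongr
        exact norm_sum_le_of_le _ fun i _ => S.lipschitz i x hx y hy
    _ = L * ‖x - y‖ := by
        rw [Finset.sum_const, Finset.card_univ, Fintype.card_fin, nsmul_eq_mul]
        field_simp

/-- Optimality of `P x` for `f + h`, with `f` linearized at `P x`. Linearization and weak convexity
each cost `L / 2`, whence `K = L`; convexity of `h` removes this error altogether. -/
lemma subgradient (S : CompositeProblem n C h f G L lam η P) (x : Vec d) {z : Vec d}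
    (hz : z ∈ C) :
    h (P x) + inner ℝ ((1 / lam) • (x - P x) - avgCol fun i => G i (P x)) (z - P x) ≤ h z := by
  have := S.convex.subgradient_of_quadratic (K := L) (S.isProx x).1
    (v := (1 / lam) • (x - P x) - avgCol fun i => G i (P x)) (fun w hw => by
      have a := (S.isProx x).variational S.weaklyConvex hw
      have b := (abs_le.1 (S.quadratic _ (S.isProx x).1 w hw)).2
      rw [inner_sub_left]
      linarith) hz
  simpa using this

/-- By `subgradient`, `P x` is the proximal point of `h` with step `η` at `P x + η • ((1 / lam) • (x
- P x) - g)`, where `g` is the average gradient at `P x`. The bound is nonexpansiveness of that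
proximal map. -/
lemma norm_prox_sub_le (S : CompositeProblem n C h f G L lam η P) {x y u : Vec d}
    (hu : IsProx C h η (x - η • y) u) :
    ‖u - P x‖ ≤ ‖(1 - η / lam) • (x - P x) - η • (y - avgCol fun i => G i (P x))‖ := by
  set g := avgCol fun i => G i (P x) with hg
  have a := S.subgradient x hu.1
  have b := hu.variational S.convex (S.isProx x).1
  rw [← hg] at a
  set w := (1 - η / lam) • (x - P x) - η • (y - g) with hw
  have hη := S.eta_pos
  have key : ‖u - P x‖ ^ 2 ≤ inner ℝ w (u - P x) := by
    have e : inner ℝ w (u - P x) - ‖u - P x‖ ^ 2 =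
        η * (-(inner ℝ ((1 / lam) • (x - P x) - g) (u - P x)
          + inner ℝ ((1 / η) • (x - η • y - u)) (P x - u))) := by
      rw [← neg_sub u (P x), inner_neg_right, neg_add, neg_neg, add_comm, ← sub_eq_add_neg,
        ← inner_sub_left, ← real_inner_self_eq_norm_sq, ← inner_sub_left]
      have : w - (u - P x) = η • ((1 / η) • (x - η • y - u) - ((1 / lam) • (x - P x) - g)) := by
        have hlam := S.lam_pos
        rw [hw]
        match_scalars <;> field_simp
        ring
      rw [this, inner_smul_left]
      rfl
    have : 0 ≤ η * (-(inner ℝ ((1 / lam) • (x - P x) - g) (u - P x)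
          + inner ℝ ((1 / η) • (x - η • y - u)) (P x - u))) := by
      apply mul_nonneg hη.le
      linarith
    linarith
  rcases eq_or_lt_of_le (norm_nonneg (u - P x)) with h0 | h0
  · rw [← h0]; exact norm_nonneg _
  · refine le_of_mul_le_mul_right ?_ h0
    have := key.trans (real_inner_le_norm _ _)
    nlinarith

variable {W : Matrix (Fin n) (Fin n) ℝ}

/-- The envelope at the mixed points, in terms of the distances of the points before mixing to the
proximal points of `x`. -/
lemma sum_proxValue_mulCols_le (S : CompositeProblem n C h f G L lam η P)
    (hW : W ∈ doublyStochastic ℝ (Fin n)) (x u : Cols d n) :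
    ∑ i, proxValue (fun x => f x + h x) lam P (mulCols u W i) ≤
      ∑ i, proxValue (fun x => f x + h x) lam P (x i) - 1 / (2 * lam) * ∑ i, ‖x i - P (x i)‖ ^ 2
        + 2 / (9 * lam) * frobSq (perp x) + 1 / (2 * lam) * ∑ i, ‖u i - P (x i)‖ ^ 2 := by
  set φ : Vec d → ℝ := fun x => f x + h x with hφ
  have hlam := S.lam_pos
  set p : Cols d n := fun j => P (x j) with hp
  have hpC : ∀ j, p j ∈ C := fun j => (S.isProx _).1
  have hL := S.L_nonneg
  have hrow : ∀ a : Fin n → ℝ, ∑ i, ∑ j, W j i * a j = ∑ j, a j := by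
    intro a
    rw [Finset.sum_comm]
    simp only [← Finset.sum_mul, sum_row_of_mem_doublyStochastic hW, one_mul]
  have step : ∀ i, proxValue φ lam P (mulCols u W i) ≤
      ∑ j, W j i * φ (p j) + L / 2 * ∑ j, W j i * ‖p j - P (avgCol x)‖ ^ 2
        + 1 / (2 * lam) * ∑ j, W j i * ‖u j - p j‖ ^ 2 := by
    intro i
    -- The test point is the mixture of the `p j` with the weights that produced the mixed point.
    have a := (S.isProx (mulCols u W i)).2 _ (mulCols_mem hW S.weaklyConvex.convex hpC i)
    have b := S.weaklyConvex.map_sum_le hL Finset.univ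
      (fun j _ => nonneg_of_mem_doublyStochastic hW) (sum_col_of_mem_doublyStochastic hW i)
      (fun j _ => hpC j) (P (avgCol x))
    have c : ‖mulCols p W i - mulCols u W i‖ ^ 2 ≤ ∑ j, W j i * ‖u j - p j‖ ^ 2 := by
      rw [norm_sub_rev, ← Pi.sub_apply, ← mulCols_sub]
      exact norm_sum_smul_sq_le _ (fun j _ => nonneg_of_mem_doublyStochastic hW)
        (sum_col_of_mem_doublyStochastic hW i) _
    have c' := mul_le_mul_of_nonneg_left c (by positivity : 0 ≤ 1 / (2 * lam))
    exact a.trans (add_le_add b c')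
  have hsum := Finset.sum_le_sum fun i (_ : i ∈ Finset.univ) => step i
  simp only [Finset.sum_add_distrib, ← Finset.mul_sum, hrow] at hsum
  have hval : ∑ i, proxValue φ lam P (x i)
      = ∑ i, φ (p i) + 1 / (2 * lam) * ∑ i, ‖x i - p i‖ ^ 2 := by
    simp only [proxValue, Finset.sum_add_distrib, Finset.mul_sum, hp, norm_sub_rev]
  -- The Jensen error is centred at `P (avgCol x)`. The constant comes from `L ≤ 1 / (4 * lam)` and
  -- the Lipschitz constant `4 / 3` of `P`.
  have hperp : L / 2 * ∑ j, ‖p j - P (avgCol x)‖ ^ 2 ≤ 2 / (9 * lam) * frobSq (perp x) := by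
    have e1 : ∑ j, ‖p j - P (avgCol x)‖ ^ 2 ≤ 16 / 9 * frobSq (perp x) := by
      rw [frobSq, Finset.mul_sum]
      refine Finset.sum_le_sum fun j _ => ?_
      have := pow_le_pow_left₀ (norm_nonneg _) (S.norm_P_sub_le (x j) (avgCol x)) 2
      rw [perp_apply]
      calc _ ≤ _ := this
        _ = _ := by ring
    have e2 : L ≤ 1 / (4 * lam) := by
      rw [le_div_iff₀ (by positivity)]; linarith [S.lam_mul_le]
    have e3 := frobSq_nonneg (perp x)
    calc L / 2 * ∑ j, ‖p j - P (avgCol x)‖ ^ 2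
        ≤ 1 / (4 * lam) / 2 * (16 / 9 * frobSq (perp x)) := by gcongr
      _ = _ := by field_simp; ring
  rw [hval]
  linarith

/-- The direction whose correlation with the gradient noise enters the descent inequality. -/
noncomputable def descentDir (G : Fin n → Vec d → Vec d) (lam η : ℝ) (P : Vec d → Vec d)
    (x : Cols d n) : Vec d :=
  avgCol fun i => (1 - η / lam) • (x i - P (x i))
    - η • ((avgCol fun j => G j (x j)) - avgCol fun j => G j (P (x i)))

/-- The average squared distance from `x i` to the columns is the mean consensus error plus the
squared deviation of `x i`; summed over `i`, each contributes one `frobSq (perp x)`. -/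
lemma sum_norm_avgCol_sub_sq_le (S : CompositeProblem n C h f G L lam η P) {x : Cols d n}
    (hx : ∀ i, x i ∈ C) :
    ∑ i, ‖(avgCol fun j => G j (x j)) - avgCol fun j => G j (x i)‖ ^ 2
      ≤ 2 * L ^ 2 * frobSq (perp x) := by
  have hn : (0 : ℝ) < n := by exact_mod_cast S.pos
  have each : ∀ i, ‖(avgCol fun j => G j (x j)) - avgCol fun j => G j (x i)‖ ^ 2
      ≤ L ^ 2 * (1 / n * frobSq (perp x) + ‖perp x i‖ ^ 2) := by
    intro i
    have a := norm_avgCol_sq_le S.pos ((fun j => G j (x j)) - fun j => G j (x i) : Cols d n)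
    have b : frobSq ((fun j => G j (x j)) - fun j => G j (x i) : Cols d n)
        ≤ L ^ 2 * ∑ j, ‖x j - x i‖ ^ 2 := by
      rw [frobSq, Finset.mul_sum]
      refine Finset.sum_le_sum fun j _ => ?_
      rw [← mul_pow]
      exact pow_le_pow_left₀ (norm_nonneg _) (S.lipschitz j _ (hx j) _ (hx i)) 2
    rw [sum_norm_sub_sq S.pos, norm_sub_rev, ← perp_apply] at b
    rw [avgCol_sub] at a
    have c : n * ‖(avgCol fun j => G j (x j)) - avgCol fun j => G j (x i)‖ ^ 2
      ≤ n * (L ^ 2 * (1 / n * frobSq (perp x) + ‖perp x i‖ ^ 2)) := by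
      refine a.trans (b.trans (le_of_eq ?_))
      field_simp
    exact le_of_mul_le_mul_left c hn
  refine (Finset.sum_le_sum fun i _ => each i).trans (le_of_eq ?_)
  rw [← Finset.mul_sum, Finset.sum_add_distrib, Finset.sum_const, Finset.card_univ,
    Fintype.card_fin, nsmul_eq_mul]
  simp only [frobSq]
  field_simp
  ring

/-- The distance of the proximal gradient step to the proximal points of the objective. -/
lemma sum_norm_prox_sub_sq_le (S : CompositeProblem n C h f G L lam η P) {x y u e : Cols d n}
    (hx : ∀ i, x i ∈ C) (hu : ∀ i, IsProx C h η (x i - η • y i) (u i))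
    (hy : avgCol y = avgCol fun i => G i (x i) + e i) :
    ∑ i, ‖u i - P (x i)‖ ^ 2 ≤ (1 - 3 * η / (4 * lam)) * ∑ i, ‖x i - P (x i)‖ ^ 2
      + 7 / 6 * frobSq (perp x) + 2 * η ^ 2 * frobSq (perp y) + η ^ 2 * frobSq e
      - 2 * η * ∑ i, inner ℝ (descentDir G lam η P x) (e i) := by
  have hη := S.eta_pos
  have hlam := S.lam_pos
  have hL := S.L_nonneg
  have hn : (0 : ℝ) < n := by exact_mod_cast S.pos
  set a := η / lam with ha
  have ha0 : 0 < a := by positivity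
  have ha1 : a ≤ 1 := by rw [ha, div_le_one hlam]; exact S.eta_le
  have hηL : η * L ≤ a / 4 := by
    have : η * L = a * (lam * L) := by rw [ha]; field_simp
    rw [this]; nlinarith [S.lam_mul_le]
  set g : Vec d := avgCol fun j => G j (x j) with hg
  set U : Cols d n := fun i => (1 - a) • (x i - P (x i))
    - η • (g - avgCol fun j => G j (P (x i))) with hU
  have hdir : descentDir G lam η P x = avgCol U := rfl
  have hy' : avgCol y = g + avgCol e := by
    rw [hy, ← avgCol_add]; rfl
  -- the step in terms of `U`, the consensus error and the noise
  have h1 : ∀ i, ‖u i - P (x i)‖ ^ 2 ≤ ‖U i - η • perp y i - η • avgCol e‖ ^ 2 := by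
    intro i
    refine pow_le_pow_left₀ (norm_nonneg _) ((S.norm_prox_sub_le (hu i)).trans (le_of_eq ?_)) 2
    congr 1
    have : y i = perp y i + (g + avgCol e) := by rw [perp_apply, ← hy']; abel
    rw [hU]
    conv_lhs => rw [this]
    simp only [smul_sub, smul_add]
    abel
  -- The columns of `perp y` sum to zero, so the average noise is paired only with `avgCol U`, the
  -- descent direction, which does not involve the current noise.
  have h2 : ∑ i, ‖U i - η • perp y i - η • avgCol e‖ ^ 2 = ∑ i, ‖U i - η • perp y i‖ ^ 2
      - 2 * η * ∑ i, inner ℝ (avgCol U) (e i) + η ^ 2 * (n * ‖avgCol e‖ ^ 2) := by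
    have e1 : ∑ i, inner ℝ (U i - η • perp y i) (η • avgCol e)
        = η * ∑ i, inner ℝ (avgCol U) (e i) := by
      rw [← sum_inner, Finset.sum_sub_distrib, ← Finset.smul_sum, sum_perp S.pos, smul_zero,
        sub_zero, inner_smul_right, ← inner_sum, avgCol, avgCol, inner_smul_right,
        inner_smul_left]
      rfl
    simp only [norm_sub_sq_real (_ - _), Finset.sum_add_distrib, Finset.sum_sub_distrib,
      ← Finset.mul_sum, e1, norm_smul, mul_pow, Finset.sum_const, Finset.card_univ,
      Fintype.card_fin, nsmul_eq_mul, Real.norm_eq_abs, sq_abs]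
    ring
  -- the correlation with the consensus error of `y`
  set c : Vec d := (1 - a) • (avgCol x - P (avgCol x))
    - η • (g - avgCol fun j => G j (P (avgCol x))) with hc
  -- Residuals are 1-Lipschitz and the gradient term has constant `η * L * 4 / 3 ≤ a / 3`, so the
  -- total is at most `1 - a + a / 3 ≤ 1`.
  have hUc : ∀ i, ‖U i - c‖ ≤ ‖perp x i‖ := by
    intro i
    have e1 : U i - c = (1 - a) • ((x i - P (x i)) - (avgCol x - P (avgCol x)))
        + η • ((avgCol fun j => G j (P (x i))) - avgCol fun j => G j (P (avgCol x))) := by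
      rw [hU, hc]; simp only [smul_sub]; abel
    have b1 := S.norm_residual_sub_le (x i) (avgCol x)
    have b2 := (S.norm_avgCol_sub_le (S.isProx (x i)).1 (S.isProx (avgCol x)).1).trans
      (mul_le_mul_of_nonneg_left (S.norm_P_sub_le (x i) (avgCol x)) hL)
    rw [e1, perp_apply]
    refine (norm_add_le _ _).trans ?_
    rw [norm_smul, norm_smul, Real.norm_of_nonneg (by linarith : 0 ≤ 1 - a),
      Real.norm_of_nonneg hη.le]
    have b3 := mul_le_mul_of_nonneg_left b1 (by linarith : 0 ≤ 1 - a)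
    have b4 := mul_le_mul_of_nonneg_left b2 hη.le
    have b5 := mul_le_mul_of_nonneg_right hηL (norm_nonneg (x i - avgCol x))
    nlinarith [mul_nonneg ha0.le (norm_nonneg (x i - avgCol x))]
  have h3 : ∑ i, ‖U i - η • perp y i‖ ^ 2
      ≤ frobSq U + frobSq (perp x) + 2 * η ^ 2 * frobSq (perp y) := by
    -- Again `perp y` sums to zero, so `U` may be centred at `c`; the cross term then costs
    -- consensus errors only and spares the contraction of `U`.
    have e1 : ∑ i, inner ℝ (U i) (perp y i) = ∑ i, inner ℝ (U i - c) (perp y i) := by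
      simp only [inner_sub_left, Finset.sum_sub_distrib, ← inner_sum, sum_perp S.pos,
        inner_zero_right, sub_zero]
    have e2 : ∑ i, ‖U i - η • perp y i‖ ^ 2 = frobSq U
        - 2 * η * ∑ i, inner ℝ (U i - c) (perp y i) + η ^ 2 * frobSq (perp y) := by
      simp only [norm_sub_sq_real, ← e1, frobSq, Finset.sum_add_distrib, Finset.sum_sub_distrib,
        Finset.mul_sum, inner_smul_right, norm_smul, mul_pow, Real.norm_eq_abs, sq_abs]
      simp only [mul_assoc]
    have e3 : -(2 * η * ∑ i, inner ℝ (U i - c) (perp y i))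
        ≤ frobSq (perp x) + η ^ 2 * frobSq (perp y) := by
      rw [frobSq, frobSq, Finset.mul_sum, Finset.mul_sum, ← Finset.sum_neg_distrib,
        ← Finset.sum_add_distrib]
      refine Finset.sum_le_sum fun i _ => ?_
      have b1 := (abs_le.1 (abs_real_inner_le_norm (U i - c) (perp y i))).1
      have b2 := mul_le_mul_of_nonneg_right (hUc i) (norm_nonneg (perp y i))
      have b3 : -inner ℝ (U i - c) (perp y i) ≤ ‖perp x i‖ * ‖perp y i‖ := by linarith
      have b4 := mul_le_mul_of_nonneg_left b3 hη.le
      nlinarith [sq_nonneg (‖perp x i‖ - η * ‖perp y i‖)]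
    linarith
  -- the size of `U`
  have h4 : frobSq U ≤ (1 - 3 * η / (4 * lam)) * ∑ i, ‖x i - P (x i)‖ ^ 2
      + 1 / 6 * frobSq (perp x) := by
    have ea : 3 * η / (4 * lam) = 3 * a / 4 := by rw [ha]; field_simp
    have each : ∀ i, ‖U i‖ ^ 2 ≤ (1 - 3 * a / 4) * ‖x i - P (x i)‖ ^ 2
        + 4 * η * lam / 3 * ‖g - avgCol fun j => G j (x i)‖ ^ 2 := by
      intro i
      have e1 : U i = ((1 - a) • (x i - P (x i)) - η • ((avgCol fun j => G j (x i))
          - avgCol fun j => G j (P (x i)))) - η • (g - avgCol fun j => G j (x i)) := by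
        rw [hU]; simp only [smul_sub]; abel
      have b1 := S.norm_avgCol_sub_le (hx i) (S.isProx (x i)).1
      have b2 : ‖U i‖ ≤ (1 - 3 * a / 4) * ‖x i - P (x i)‖
          + η * ‖g - avgCol fun j => G j (x i)‖ := by
        rw [e1]
        refine (norm_sub_le _ _).trans (add_le_add ((norm_sub_le _ _).trans ?_) ?_)
        · rw [norm_smul, norm_smul, Real.norm_of_nonneg (by linarith : 0 ≤ 1 - a),
            Real.norm_of_nonneg hη.le]
          have b4 := mul_le_mul_of_nonneg_left b1 hη.le
          have b5 := mul_le_mul_of_nonneg_right hηL (norm_nonneg (x i - P (x i)))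
          linarith
        · rw [norm_smul, Real.norm_of_nonneg hη.le]
      have b3 := pow_le_pow_left₀ (norm_nonneg _) b2 2
      refine b3.trans ?_
      set D := ‖x i - P (x i)‖
      set B := ‖g - avgCol fun j => G j (x i)‖
      -- Convexity of the square with weights `1 - 3 * a / 4` and `3 * a / 4`, the contraction
      -- factor being `(1 - a) + a / 4`; here `η ^ 2 / (3 * a / 4) = 4 * η * lam / 3`.
      have e2 : (1 - 3 * a / 4) * D ^ 2 + 4 * η * lam / 3 * B ^ 2
          - ((1 - 3 * a / 4) * D + η * B) ^ 2
          = (1 - 3 * a / 4) * (4 / (3 * a)) * (3 * a / 4 * D - η * B) ^ 2 := by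
        have : η = a * lam := by rw [ha]; field_simp
        rw [this]
        field_simp
        ring
      have e3 : 0 ≤ (1 - 3 * a / 4) * (4 / (3 * a)) * (3 * a / 4 * D - η * B) ^ 2 := by
        have : 0 ≤ 1 - 3 * a / 4 := by linarith
        positivity
      linarith
    rw [ea]
    have hs := Finset.sum_le_sum fun i (_ : i ∈ Finset.univ) => each i
    rw [Finset.sum_add_distrib, ← Finset.mul_sum, ← Finset.mul_sum] at hs
    have b := S.sum_norm_avgCol_sub_sq_le hx
    have b' := mul_le_mul_of_nonneg_left b (by positivity : 0 ≤ 4 * η * lam / 3)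
    have e4 : 4 * η * lam / 3 * (2 * L ^ 2 * frobSq (perp x)) ≤ 1 / 6 * frobSq (perp x) := by
      have : 4 * η * lam / 3 * (2 * L ^ 2) ≤ 1 / 6 := by
        have i1 : η * L ≤ 1 / 4 := by linarith
        have i2 : (η * L) * (lam * L) ≤ 1 / 4 * (1 / 4) :=
          mul_le_mul i1 S.lam_mul_le (by positivity) (by norm_num)
        nlinarith
      calc _ = 4 * η * lam / 3 * (2 * L ^ 2) * frobSq (perp x) := by ring
        _ ≤ _ := mul_le_mul_of_nonneg_right this (frobSq_nonneg _)
    exact hs.trans (by linarith)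
  have h5 := mul_le_mul_of_nonneg_left (norm_avgCol_sq_le S.pos e) (sq_nonneg η)
  have h6 := Finset.sum_le_sum fun i (_ : i ∈ Finset.univ) => h1 i
  rw [hdir]
  linarith

/-- Comparing every `u i` with the proximal point at the averaged argument, nonexpansiveness shows
that the proximal map does not increase consensus error. Mixing then contracts it. -/
lemma frobSq_perp_mulCols_prox_le (S : CompositeProblem n C h f G L lam η P)
    (hW : W ∈ doublyStochastic ℝ (Fin n)) (hρ : specNorm (W - avgMat n) < 1) {x y u : Cols d n}
    (hu : ∀ i, IsProx C h η (x i - η • y i) (u i)) :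
    frobSq (perp (mulCols u W)) ≤ (1 + specNorm (W - avgMat n) ^ 2) / 2 * frobSq (perp x)
      + 2 * specNorm (W - avgMat n) ^ 2 / (1 - specNorm (W - avgMat n) ^ 2)
        * (η ^ 2 * frobSq (perp y)) := by
  set ρ := specNorm (W - avgMat n)
  have hρ0 : 0 ≤ ρ := norm_nonneg _
  obtain ⟨p, hp⟩ := S.exists_prox (avgCol x - η • avgCol y)
  have a : frobSq (perp u) ≤ frobSq (perp x + (-η) • perp y) := by
    refine (frobSq_perp_le_sum S.pos u p).trans (Finset.sum_le_sum fun i _ => ?_)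
    refine pow_le_pow_left₀ (norm_nonneg _) ?_ 2
    have := (hu i).norm_sub_le S.convex S.eta_pos hp
    rw [mul_zero, sub_zero, one_mul] at this
    refine this.trans (le_of_eq ?_)
    rw [Pi.add_apply, Pi.smul_apply, perp_apply, perp_apply]
    congr 1
    simp only [smul_sub, neg_smul]
    abel
  have b : frobSq ((-η) • perp y) = η ^ 2 * frobSq (perp y) := by
    simp [frobSq, norm_smul, mul_pow, Finset.mul_sum]
  rw [perp_mulCols hW, ← b]
  refine (frobSq_mulCols_sub_avgMat_le S.pos hW u).trans ?_
  exact (mul_le_mul_of_nonneg_left a (sq_nonneg _)).trans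
    (frobSq_young _ _ (sq_nonneg _) (by nlinarith))

end CompositeProblem

/-- The increment is split through the mixtures of `p` and of `x`; the last part, the displacement
by mixing, is a pure consensus error. -/
lemma frobSq_mulCols_sub_le {W : Matrix (Fin n) (Fin n) ℝ}
    (hW : W ∈ doublyStochastic ℝ (Fin n)) (x p u : Cols d n) :
    frobSq (mulCols u W - x) ≤ 3 * frobSq (u - p) + 3 * frobSq (x - p)
      + 12 * frobSq (perp x) := by
  have e : mulCols u W - x = mulCols (u - p) W + mulCols (p - x) W + (mulCols x W - x) := by
    rw [mulCols_sub, mulCols_sub]; abel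
  have a := frobSq_add_add_le (mulCols (u - p) W) (mulCols (p - x) W) (mulCols x W - x)
  rw [← e] at a
  have b := frobSq_sub_le (mulCols (perp x) W) (perp x)
  rw [← mulCols_sub_self hW] at b
  have c := frobSq_mulCols_doublyStochastic_le hW (perp x)
  have c1 := frobSq_mulCols_doublyStochastic_le hW (u - p)
  have c2 := frobSq_mulCols_doublyStochastic_le hW (p - x)
  have c3 : frobSq (p - x) = frobSq (x - p) := by simp [frobSq, norm_sub_rev]
  linarith

/-- The consensus error of the tracked gradient, split into its part `z` that does not depend on
the current noise `e` and the noise. -/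
lemma frobSq_add_mulCols_le {W : Matrix (Fin n) (Fin n) ℝ} (hρ : specNorm (W - avgMat n) < 1)
    (z e : Cols d n) :
    frobSq (z + mulCols e (W - avgMat n)) ≤ frobSq z
      + 2 * ∑ i, inner ℝ (mulCols z (W - avgMat n).transpose i) (e i) + frobSq e := by
  rw [frobSq_add, sum_inner_mulCols]
  have hρ0 : 0 ≤ specNorm (W - avgMat n) := norm_nonneg _
  have a := frobSq_mulCols_le e (W - avgMat n)
  have b : specNorm (W - avgMat n) ^ 2 * frobSq e ≤ 1 * frobSq e :=
    mul_le_mul_of_nonneg_right (by nlinarith) (frobSq_nonneg _)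
  linarith

/-- The noise `e` returns once mixed and once as the old stochastic gradient being subtracted, so it
acts through `R - 1`. Its pairing with `z` is kept exact because it will average to zero; `D` may
depend on `e` and is split off by Young's inequality. -/
lemma frobSq_mulCols_tracking_le {W : Matrix (Fin n) (Fin n) ℝ}
    (hρ : specNorm (W - avgMat n) < 1) (z e D : Cols d n) :
    frobSq (mulCols (z + mulCols e (W - avgMat n) - e + D) (W - avgMat n)) ≤
      (1 + specNorm (W - avgMat n) ^ 2) / 2 * (frobSq z
        + 2 * ∑ i, inner ℝ (mulCols z (W - avgMat n - 1).transpose i) (e i) + 4 * frobSq e)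
      + 2 * specNorm (W - avgMat n) ^ 2 / (1 - specNorm (W - avgMat n) ^ 2) * frobSq D := by
  set R := W - avgMat n
  have hρ0 : 0 ≤ specNorm R := norm_nonneg _
  have hρ2 : specNorm R ^ 2 < 1 := by nlinarith
  have a : frobSq (mulCols (z + mulCols e R - e + D) R)
      ≤ specNorm R ^ 2 * frobSq ((z + mulCols e (R - 1)) + D) := by
    refine (frobSq_mulCols_le _ _).trans (le_of_eq ?_)
    rw [mulCols_sub_right e R, mulCols_one]
    congr 2
    abel
  have b := frobSq_young (z + mulCols e (R - 1)) D (sq_nonneg (specNorm R)) hρ2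
  have c : frobSq (z + mulCols e (R - 1)) ≤ frobSq z
      + 2 * ∑ i, inner ℝ (mulCols z (R - 1).transpose i) (e i) + 4 * frobSq e := by
    rw [frobSq_add, sum_inner_mulCols]
    have c1 := frobSq_sub_le (mulCols e R) e
    have c2 := frobSq_mulCols_le e R
    have c3 := mul_le_mul_of_nonneg_right hρ2.le (frobSq_nonneg e)
    rw [mulCols_sub_right e R, mulCols_one]
    linarith
  have d1 := mul_le_mul_of_nonneg_left c (by positivity : 0 ≤ (1 + specNorm R ^ 2) / 2)
  linarith

end OneStep

/-! ### Summing the coupled scalar recursions. -/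

section Recursion

lemma sum_range_le_of_recursion {a b : ℕ → ℝ} {κ : ℝ} (T : ℕ) (ha : ∀ t, 0 ≤ a t)
    (h : ∀ t, a (t + 1) ≤ (1 + κ) / 2 * a t + b t) :
    (1 - κ) / 2 * ∑ t ∈ Finset.range T, a t ≤ a 0 + ∑ t ∈ Finset.range T, b t := by
  have key : (1 - κ) / 2 * ∑ t ∈ Finset.range T, a t + a T
      ≤ a 0 + ∑ t ∈ Finset.range T, b t := by
    induction T with
    | zero => simp
    | succ T ih =>
      rw [Finset.sum_range_succ, Finset.sum_range_succ]
      linarith [h T]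
  linarith [ha T]

set_option maxHeartbeats 1000000 in
/-- The convergence rate, as a consequence of the one-step inequalities for the expected envelope
`Φ`, stationarity measure `D`, consensus errors `X` and `Y` of the iterates and of the tracked
gradients, predictable part `Z` of the latter, squared distance `B` of the proximal step to the
proximal points, and squared increments `V`. -/
theorem sum_le_of_one_step {ρ L lam η N G0 Φinf : ℝ} {Φ D X Y Z B V : ℕ → ℝ} (T : ℕ)
    (hρ0 : 0 ≤ ρ) (hρ1 : ρ < 1) (hL : 0 ≤ L) (hlam : 0 < lam) (hη : 0 < η) (hN : 0 ≤ N)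
    (hG0 : 0 ≤ G0) (h1 : ρ * η * L ≤ (1 - ρ ^ 2) ^ 4 / 96) (h2 : ρ * lam * L ≤ 1 / 96)
    (hD : ∀ t, 0 ≤ D t) (hX : ∀ t, 0 ≤ X t) (hY : ∀ t, 0 ≤ Y t) (hZ : ∀ t, 0 ≤ Z t)
    (hΦ : ∀ t, Φ (t + 1) ≤ Φ t - 1 / (2 * lam) * D t + 2 / (9 * lam) * X t
      + 1 / (2 * lam) * B t)
    (hB : ∀ t, B t ≤ (1 - 3 * η / (4 * lam)) * D t + 7 / 6 * X t + 2 * η ^ 2 * Y t + η ^ 2 * N)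
    (hX0 : X 0 = 0)
    (hX1 : ∀ t, X (t + 1) ≤ (1 + ρ ^ 2) / 2 * X t + 2 * ρ ^ 2 / (1 - ρ ^ 2) * (η ^ 2 * Y t))
    (hYZ : ∀ t, Y t ≤ Z t + N) (hZ0 : Z 0 ≤ G0)
    (hZ1 : ∀ t, Z (t + 1) ≤ (1 + ρ ^ 2) / 2 * (Z t + 4 * N)
      + 2 * ρ ^ 2 / (1 - ρ ^ 2) * (L ^ 2 * V t))
    (hV : ∀ t, V t ≤ 3 * B t + 3 * D t + 12 * X t) (hinf : Φinf ≤ Φ T) :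
    ∑ t ∈ Finset.range T, (1 / lam ^ 2 * D t + 4 / (lam * η) * X t)
      ≤ 8 * (Φ 0 - Φinf) / η + 4616 * η / (lam * (1 - ρ ^ 2) ^ 3) * (N * T)
        + 768 * η / (lam * (1 - ρ ^ 2) ^ 3) * G0 := by
  set q := 1 - ρ ^ 2 with hq
  have hq0 : 0 < q := by nlinarith
  have hq1 : q ≤ 1 := by nlinarith [sq_nonneg ρ]
  have hκ : ρ ^ 2 ≤ 1 := by nlinarith
  set SD := ∑ t ∈ Finset.range T, D t with hSD
  set SX := ∑ t ∈ Finset.range T, X t with hSX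
  set SY := ∑ t ∈ Finset.range T, Y t with hSY
  set SZ := ∑ t ∈ Finset.range T, Z t with hSZ
  set SV := ∑ t ∈ Finset.range T, V t with hSV
  have hSD0 : 0 ≤ SD := Finset.sum_nonneg fun t _ => hD t
  have hSX0 : 0 ≤ SX := Finset.sum_nonneg fun t _ => hX t
  have hSY0 : 0 ≤ SY := Finset.sum_nonneg fun t _ => hY t
  have hconst : ∀ c : ℝ, ∑ t ∈ Finset.range T, c = c * T := fun c => by simp [mul_comm]
  set M := N * T with hM
  have hM0 : 0 ≤ M := by positivity
  -- summed descent
  have descent : 3 * η / (8 * lam ^ 2) * SD ≤ Φ 0 - Φinf + 29 / (36 * lam) * SX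
      + η ^ 2 / lam * SY + η ^ 2 / (2 * lam) * M := by
    have each : ∀ t, 3 * η / (8 * lam ^ 2) * D t ≤ (Φ t - Φ (t + 1)) + 29 / (36 * lam) * X t
        + η ^ 2 / lam * Y t + η ^ 2 / (2 * lam) * N := by
      intro t
      have a := mul_le_mul_of_nonneg_left (hB t) (by positivity : 0 ≤ 1 / (2 * lam))
      have b := hΦ t
      have e : 1 / (2 * lam) * ((1 - 3 * η / (4 * lam)) * D t + 7 / 6 * X t + 2 * η ^ 2 * Y t
          + η ^ 2 * N) = 1 / (2 * lam) * D t - 3 * η / (8 * lam ^ 2) * D t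
          + 7 / (12 * lam) * X t + η ^ 2 / lam * Y t + η ^ 2 / (2 * lam) * N := by
        field_simp; ring
      have e2 : 29 / (36 * lam) * X t = 2 / (9 * lam) * X t + 7 / (12 * lam) * X t := by
        field_simp; ring
      linarith
    have := Finset.sum_le_sum fun t (_ : t ∈ Finset.range T) => each t
    simp only [Finset.sum_add_distrib, ← Finset.mul_sum, Finset.sum_range_sub', hconst] at this
    rw [mul_assoc (η ^ 2 / (2 * lam)) N, ← hM] at this
    linarith
  -- summed consensus recursions
  have consX : q ^ 2 * SX ≤ 4 * ρ ^ 2 * η ^ 2 * SY := by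
    have := sum_range_le_of_recursion T hX hX1
    rw [hX0, ← Finset.mul_sum, ← Finset.mul_sum, ← hSX, ← hSY, ← hq] at this
    calc q ^ 2 * SX = 2 * q * (q / 2 * SX) := by ring
      _ ≤ 2 * q * (0 + 2 * ρ ^ 2 / q * (η ^ 2 * SY)) := by gcongr
      _ = _ := by field_simp; ring
  have consY : q ^ 2 * SY ≤ 2 * q * G0 + 9 * q * M + 4 * (ρ ^ 2 * L ^ 2) * SV := by
    have := sum_range_le_of_recursion (b := fun t => (1 + ρ ^ 2) / 2 * (4 * N)
      + 2 * ρ ^ 2 / q * (L ^ 2 * V t)) (κ := ρ ^ 2) T hZ (fun t => by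
        have := hZ1 t; linarith)
    simp only [Finset.sum_add_distrib, ← Finset.mul_sum, hconst] at this
    rw [← hSZ, ← hSV, ← hq] at this
    have a : (1 + ρ ^ 2) / 2 * (4 * N) * T ≤ 4 * M := by
      have : (1 + ρ ^ 2) / 2 ≤ 1 := by linarith
      calc (1 + ρ ^ 2) / 2 * (4 * N) * T = (1 + ρ ^ 2) / 2 * (4 * M) := by rw [hM]; ring
        _ ≤ 1 * (4 * M) := by gcongr
        _ = _ := one_mul _
    have b : SY ≤ SZ + M := by
      have := Finset.sum_le_sum fun t (_ : t ∈ Finset.range T) => hYZ t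
      simpa only [Finset.sum_add_distrib, hconst] using this
    have c : q ^ 2 * SZ ≤ 2 * q * G0 + 8 * q * M + 4 * (ρ ^ 2 * L ^ 2) * SV := by
      calc q ^ 2 * SZ = 2 * q * (q / 2 * SZ) := by ring
        _ ≤ 2 * q * (G0 + (4 * M + 2 * ρ ^ 2 / q * (L ^ 2 * SV))) := by
          gcongr
          linarith
        _ = _ := by field_simp; ring
    have d := mul_le_mul_of_nonneg_left b (sq_nonneg q)
    have e : q ^ 2 * M ≤ q * M := by
      apply mul_le_mul_of_nonneg_right _ hM0; nlinarith
    linarith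
  have boundV : SV ≤ 6 * SD + 31 / 2 * SX + 6 * η ^ 2 * SY + 3 * η ^ 2 * M := by
    have each : ∀ t, V t ≤ 6 * D t + 31 / 2 * X t + 6 * η ^ 2 * Y t + 3 * η ^ 2 * N := by
      intro t
      have : 0 ≤ 3 * η / (4 * lam) * D t := mul_nonneg (by positivity) (hD t)
      linarith [hV t, hB t]
    have := Finset.sum_le_sum fun t (_ : t ∈ Finset.range T) => each t
    simp only [Finset.sum_add_distrib, ← Finset.mul_sum, hconst] at this
    rw [mul_assoc (3 * η ^ 2) N, ← hM] at this
    exact this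
  -- the step size restrictions
  set K := ρ ^ 2 * L ^ 2 with hK
  have hK0 : 0 ≤ K := by positivity
  have hρη : 0 ≤ ρ * η * L := by positivity
  have hρl : 0 ≤ ρ * lam * L := by positivity
  -- Here `9216 = 96 ^ 2`.
  have k1 : K * η ^ 2 ≤ q ^ 8 / 9216 := by
    have := pow_le_pow_left₀ hρη h1 2
    calc K * η ^ 2 = (ρ * η * L) ^ 2 := by rw [hK]; ring
      _ ≤ _ := this
      _ = _ := by ring
  have k2 : K * η * lam ≤ q ^ 4 / 9216 := by
    have := mul_le_mul h1 h2 hρl (by positivity)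
    calc K * η * lam = ρ * η * L * (ρ * lam * L) := by rw [hK]; ring
      _ ≤ _ := this
      _ = _ := by ring
  have hq86 : q ^ 6 ≤ q ^ 2 := pow_le_pow_of_le_one hq0.le hq1 (by norm_num)
  have hq82 : q ^ 8 ≤ q ^ 2 := pow_le_pow_of_le_one hq0.le hq1 (by norm_num)
  have hq81 : q ^ 8 ≤ q := by simpa using pow_le_pow_of_le_one hq0.le hq1 (show 1 ≤ 8 by norm_num)
  have kY : K * η ^ 2 * SY ≤ q ^ 2 / 9216 * SY := by
    gcongr; linarith
  have kM : K * η ^ 2 * M ≤ q / 9216 * M := by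
    gcongr; linarith
  have kX : K * SX ≤ 4 * q ^ 2 / 9216 * SY := by
    have a : q ^ 2 * (K * SX) ≤ q ^ 2 * (4 * q ^ 6 / 9216 * SY) := by
      calc q ^ 2 * (K * SX) = K * (q ^ 2 * SX) := by ring
        _ ≤ K * (4 * ρ ^ 2 * η ^ 2 * SY) := by gcongr
        _ = ρ ^ 2 * (4 * (K * η ^ 2) * SY) := by ring
        _ ≤ 1 * (4 * (q ^ 8 / 9216) * SY) := by gcongr
        _ = _ := by ring
    refine (le_of_mul_le_mul_left a (by positivity)).trans ?_
    gcongr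
  -- The loop is closed: through the increments, `SY` bounds itself with gain `(62 * 4 + 24) /
  -- 9216`, which is absorbed on the left by rounding up the other coefficients.
  have boundY : q ^ 2 * SY ≤ 3 * q * G0 + 10 * q * M + 25 * K * SD := by
    have a := mul_le_mul_of_nonneg_left boundV (by positivity : 0 ≤ 4 * K)
    have g : 0 ≤ q * G0 := by positivity
    have m : 0 ≤ q * M := by positivity
    have d : 0 ≤ K * SD := by positivity
    have e : 4 * K * (6 * SD + 31 / 2 * SX + 6 * η ^ 2 * SY + 3 * η ^ 2 * M) = 24 * (K * SD)
      + 62 * (K * SX) + 24 * (K * η ^ 2 * SY) + 12 * (K * η ^ 2 * M) := by ring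
    rw [e] at a
    linarith only [a, g, m, d, consY, kX, kY, kM]
  -- conclusion
  have final : 94 / (9 * (lam * η)) * SX + 8 * η / lam * SY ≤ 150 * η / (lam * q ^ 3) * G0
      + 500 * η / (lam * q ^ 3) * M + 2 / lam ^ 2 * SD := by
    -- `94 / 9 = 58 / 9 + 4` joins the consensus term of the scaled descent to that of the target.
    -- With `376 / 9 ≤ 42`, everything becomes `42 + 8 = 50` multiples of `SY`.
    have a : 94 / (9 * (lam * η)) * SX ≤ 42 * η / (lam * q ^ 2) * SY := by
      calc 94 / (9 * (lam * η)) * SX = 94 / (9 * (lam * η) * q ^ 2) * (q ^ 2 * SX) := by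
            field_simp
        _ ≤ 94 / (9 * (lam * η) * q ^ 2) * (4 * 1 * η ^ 2 * SY) := by
            exact mul_le_mul_of_nonneg_left (consX.trans (by gcongr)) (by positivity)
        _ = 376 / 9 * (η / (lam * q ^ 2) * SY) := by field_simp; ring
        _ ≤ 42 * (η / (lam * q ^ 2) * SY) := by gcongr; norm_num
        _ = _ := by ring
    have b : 8 * η / lam * SY ≤ 8 * η / (lam * q ^ 2) * SY := by
      gcongr
      exact mul_le_of_le_one_right hlam.le (pow_le_one₀ hq0.le hq1)
    have c : 50 * η / (lam * q ^ 2) * SY ≤ 150 * η / (lam * q ^ 3) * G0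
        + 500 * η / (lam * q ^ 3) * M + 1250 * (K * η * lam) / (lam ^ 2 * q ^ 4) * SD := by
      calc 50 * η / (lam * q ^ 2) * SY = 50 * η / (lam * q ^ 4) * (q ^ 2 * SY) := by field_simp
        _ ≤ 50 * η / (lam * q ^ 4) * (3 * q * G0 + 10 * q * M + 25 * K * SD) := by gcongr
        _ = _ := by field_simp; ring
    have e : 1250 * (K * η * lam) / (lam ^ 2 * q ^ 4) * SD ≤ 2 / lam ^ 2 * SD := by
      refine mul_le_mul_of_nonneg_right ?_ hSD0
      rw [div_le_div_iff₀ (by positivity) (by positivity)]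
      have : 1250 * (K * η * lam) ≤ 2 * q ^ 4 := by
        have : 0 ≤ q ^ 4 := by positivity
        linarith
      linarith only [mul_le_mul_of_nonneg_right this (sq_nonneg lam)]
    have e2 : 50 * η / (lam * q ^ 2) * SY = 42 * η / (lam * q ^ 2) * SY
      + 8 * η / (lam * q ^ 2) * SY := by ring
    linarith only [a, b, c, e, e2]
  have scaled := mul_le_mul_of_nonneg_left descent (by positivity : 0 ≤ 8 / η)
  -- One third of the descent is the target; the other two thirds pay for the `SD` fed back through
  -- `SY`.
  have s1 : 8 / η * (3 * η / (8 * lam ^ 2) * SD) = 1 / lam ^ 2 * SD + 2 / lam ^ 2 * SD := by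
    field_simp; ring
  have s2 : 8 / η * (Φ 0 - Φinf + 29 / (36 * lam) * SX + η ^ 2 / lam * SY
      + η ^ 2 / (2 * lam) * M) = 8 * (Φ 0 - Φinf) / η + 58 / (9 * (lam * η)) * SX
      + 8 * η / lam * SY + 4 * η / lam * M := by
    field_simp; ring
  have s3 : 94 / (9 * (lam * η)) * SX = 58 / (9 * (lam * η)) * SX + 4 / (lam * η) * SX := by
    field_simp; ring
  have s4 : 4 * η / lam * M ≤ 4 * η / (lam * q ^ 3) * M := by
    gcongr
    exact mul_le_of_le_one_right hlam.le (pow_le_one₀ hq0.le hq1)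
  -- The argument yields the constants `504` and `150`; the rest of `4616` and `768` is slack.
  have s5 : 4616 * η / (lam * q ^ 3) * M = 4 * η / (lam * q ^ 3) * M
      + 500 * η / (lam * q ^ 3) * M + 4112 * η / (lam * q ^ 3) * M := by ring
  have s6 : 768 * η / (lam * q ^ 3) * G0 = 150 * η / (lam * q ^ 3) * G0
      + 618 * η / (lam * q ^ 3) * G0 := by ring
  have s7 : 0 ≤ 4112 * η / (lam * q ^ 3) * M := by positivity
  have s8 : 0 ≤ 618 * η / (lam * q ^ 3) * G0 := by positivity
  rw [Finset.sum_add_distrib, ← Finset.mul_sum, ← Finset.mul_sum]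
  linarith only [scaled, s1, s2, s3, s4, s5, s6, s7, s8, final]

end Recursion

/-! ### Square-integrable random vectors measurable for a given σ-algebra. -/

section SquareIntegrable

variable {d : ℕ} {Ω : Type*}

/-- An `m`-measurable square-integrable random vector. -/
structure SqIntegrable (m : MeasurableSpace Ω) {mΩ : MeasurableSpace Ω} (μ : Measure Ω)
    (X : Ω → Vec d) : Prop where
  measurable : Measurable[m] X
  memLp : MemLp X 2 μ

variable {m mΩ : MeasurableSpace Ω} {μ : Measure Ω} {X Y : Ω → Vec d}

namespace SqIntegrable

lemma add (hX : SqIntegrable m μ X) (hY : SqIntegrable m μ Y) :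
    SqIntegrable m μ (fun ω => X ω + Y ω) :=
  ⟨hX.measurable.add hY.measurable, hX.memLp.add hY.memLp⟩

lemma sub (hX : SqIntegrable m μ X) (hY : SqIntegrable m μ Y) :
    SqIntegrable m μ (fun ω => X ω - Y ω) :=
  ⟨hX.measurable.sub hY.measurable, hX.memLp.sub hY.memLp⟩

lemma const_smul (hX : SqIntegrable m μ X) (c : ℝ) : SqIntegrable m μ (fun ω => c • X ω) :=
  ⟨hX.measurable.const_smul c, hX.memLp.const_smul c⟩

lemma const [IsFiniteMeasure μ] (c : Vec d) : SqIntegrable m μ (fun _ : Ω => c) :=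
  ⟨measurable_const, memLp_const c⟩

lemma sum {ι : Type*} (s : Finset ι) {X : ι → Ω → Vec d}
    (hX : ∀ i ∈ s, SqIntegrable m μ (X i)) : SqIntegrable m μ (fun ω => ∑ i ∈ s, X i ω) :=
  ⟨Finset.measurable_sum s fun i hi => (hX i hi).measurable,
    memLp_finsetSum s fun i hi => (hX i hi).memLp⟩

lemma mulCols {n : ℕ} {X : Ω → Cols d n} (hX : ∀ i, SqIntegrable m μ fun ω => X ω i)
    (A : Matrix (Fin n) (Fin n) ℝ) (i : Fin n) :
    SqIntegrable m μ fun ω => mulCols (X ω) A i :=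
  sum _ fun j _ => (hX j).const_smul (A j i)

lemma perp {n : ℕ} {X : Ω → Cols d n} (hX : ∀ i, SqIntegrable m μ fun ω => X ω i) (i : Fin n) :
    SqIntegrable m μ fun ω => perp (X ω) i := mulCols hX _ i

lemma avgCol {n : ℕ} {X : Ω → Cols d n} (hX : ∀ i, SqIntegrable m μ fun ω => X ω i) :
    SqIntegrable m μ fun ω => avgCol (X ω) :=
  (sum _ fun j _ => hX j).const_smul _

/-- `K` is controlled only on `C`, so measurability goes through the subtype. Square integrability
follows from linear growth around the value at one sample point. -/
lemma comp_lipschitzOn [IsFiniteMeasure μ] (hm : m ≤ mΩ) {C : Set (Vec d)}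
    {K : Vec d → Vec d} {c : ℝ} (hK : ∀ x ∈ C, ∀ y ∈ C, ‖K x - K y‖ ≤ c * ‖x - y‖)
    (hX : SqIntegrable m μ X) (hXC : ∀ ω, X ω ∈ C) : SqIntegrable m μ fun ω => K (X ω) := by
  have hmeas : Measurable[m] fun ω => K (X ω) := by
    have h1 : Measurable (C.domRestrict K) := by
      refine (LipschitzWith.of_dist_le' (K := c) fun x y => ?_).continuous.measurable
      rw [dist_eq_norm, Subtype.dist_eq, dist_eq_norm]
      exact hK x x.2 y y.2
    exact h1.comp (hX.measurable.subtype_mk (h := hXC))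
  refine ⟨hmeas, ?_⟩
  rcases isEmpty_or_nonempty Ω with hΩ | ⟨⟨ω0⟩⟩
  · rw [Measure.eq_zero_of_isEmpty μ]; exact memLp_measure_zero
  have hb := ((hX.memLp.sub (memLp_const (X ω0))).norm.const_mul c).add
    (memLp_const (μ := μ) ‖K (X ω0)‖)
  refine hb.mono' (hmeas.mono hm le_rfl).aestronglyMeasurable
    (Filter.Eventually.of_forall fun ω => ?_)
  have a := hK _ (hXC ω) _ (hXC ω0)
  have b := norm_sub_norm_le (K (X ω)) (K (X ω0))
  simp only [Pi.add_apply, Pi.sub_apply]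
  linarith

lemma integrable_sq (hX : SqIntegrable m μ X) : Integrable (fun ω => ‖X ω‖ ^ 2) μ :=
  hX.memLp.integrable_norm_pow (by norm_num)

lemma measurable_sq (hX : SqIntegrable m μ X) : Measurable[m] (fun ω => ‖X ω‖ ^ 2) :=
  (measurable_norm.comp hX.measurable).pow_const 2

lemma integrable_frobSq {n : ℕ} {X : Ω → Cols d n} (hX : ∀ i, SqIntegrable m μ fun ω => X ω i) :
    Integrable (fun ω => frobSq (X ω)) μ :=
  integrable_finsetSum _ fun i _ => (hX i).integrable_sq

lemma measurable_frobSq {n : ℕ} {X : Ω → Cols d n}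
    (hX : ∀ i, SqIntegrable m μ fun ω => X ω i) : Measurable[m] (fun ω => frobSq (X ω)) :=
  Finset.measurable_sum _ fun i _ => (hX i).measurable_sq

end SqIntegrable

lemma integrable_inner_of_memLp (hX : MemLp X 2 μ) (hY : MemLp Y 2 μ) :
    Integrable (fun ω => inner ℝ (X ω) (Y ω)) μ := by
  refine ((hX.integrable_norm_pow (by norm_num)).add
    (hY.integrable_norm_pow (by norm_num))).mono'
    (hX.aestronglyMeasurable.inner hY.aestronglyMeasurable)
    (Filter.Eventually.of_forall fun ω => ?_)
  have := abs_real_inner_le_norm (X ω) (Y ω)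
  simp only [Real.norm_eq_abs, Pi.add_apply]
  nlinarith [sq_nonneg (‖X ω‖ - ‖Y ω‖), sq_nonneg ‖X ω‖, sq_nonneg ‖Y ω‖,
    norm_nonneg (X ω), norm_nonneg (Y ω)]

/-- Transfers the pointwise one-step inequalities to expectations. Five terms suffice each time;
spare slots receive the zero function. -/
lemma integral_le_of_le_linear_combination {f g₁ g₂ g₃ g₄ g₅ : Ω → ℝ} {c₁ c₂ c₃ c₄ c₅ : ℝ}
    (hf : Integrable f μ) (h₁ : Integrable g₁ μ) (h₂ : Integrable g₂ μ) (h₃ : Integrable g₃ μ)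
    (h₄ : Integrable g₄ μ) (h₅ : Integrable g₅ μ)
    (h : ∀ ω, f ω ≤ c₁ * g₁ ω + c₂ * g₂ ω + c₃ * g₃ ω + c₄ * g₄ ω + c₅ * g₅ ω) :
    ∫ ω, f ω ∂μ ≤ c₁ * ∫ ω, g₁ ω ∂μ + c₂ * ∫ ω, g₂ ω ∂μ + c₃ * ∫ ω, g₃ ω ∂μ
      + c₄ * ∫ ω, g₄ ω ∂μ + c₅ * ∫ ω, g₅ ω ∂μ := by
  have i₂ := (h₁.const_mul c₁).add (h₂.const_mul c₂)
  have i₃ := i₂.add (h₃.const_mul c₃)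
  have i₄ := i₃.add (h₄.const_mul c₄)
  have i₅ := i₄.add (h₅.const_mul c₅)
  refine (integral_mono hf i₅ h).trans (le_of_eq ?_)
  rw [integral_add' i₄ (h₅.const_mul c₅), integral_add' i₃ (h₄.const_mul c₄),
    integral_add' i₂ (h₃.const_mul c₃), integral_add' (h₁.const_mul c₁) (h₂.const_mul c₂)]
  simp only [integral_const_mul]

end SquareIntegrable

/-! ### Noise from a fresh sample at a point that is independent of it. -/

section Noise

variable {d : ℕ} {Ω Ξ : Type*} {m mΩ : MeasurableSpace Ω} [MeasurableSpace Ξ] {μ : Measure Ω}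
  [IsProbabilityMeasure μ] {D : Measure Ξ} [IsProbabilityMeasure D] {ξ : Ω → Ξ}
  {C : Set (Vec d)} {e : Vec d → Ξ → Vec d} {x : Ω → Vec d} {σ : ℝ}

lemma map_prodMk_eq_of_indep {Ψ : Type*} [MeasurableSpace Ψ] {Z : Ω → Ψ} (hm : m ≤ mΩ)
    (hξ : Measurable ξ) (hind : Indep m (MeasurableSpace.comap ξ inferInstance) μ)
    (hZ : Measurable[m] Z) :
    μ.map (fun ω => (Z ω, ξ ω)) = (μ.map Z).prod (μ.map ξ) := by
  have hI : IndepFun Z ξ μ := by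
    rw [IndepFun_iff_Indep]
    exact indep_of_indep_of_le_left hind hZ.comap_le
  exact (indepFun_iff_map_prod_eq_prod_map_map (hZ.mono hm le_rfl).aemeasurable
    hξ.aemeasurable).1 hI

/-- The joint law of point and sample is a product, so the variance bound holds for each frozen
point. Lower Lebesgue integrals are used because integrability is itself a conclusion. -/
theorem memLp_noise (hm : m ≤ mΩ) (hξ : Measurable ξ) (hlaw : μ.map ξ = D)
    (hind : Indep m (MeasurableSpace.comap ξ inferInstance) μ)
    (he : Measurable fun p : C × Ξ => e p.1 p.2)
    (hvar : ∀ x ∈ C, Integrable (fun s => ‖e x s‖ ^ 2) D ∧ ∫ s, ‖e x s‖ ^ 2 ∂D ≤ σ ^ 2)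
    (hxC : ∀ ω, x ω ∈ C) (hx : Measurable[m] x) :
    MemLp (fun ω => e (x ω) (ξ ω)) 2 μ ∧ ∫ ω, ‖e (x ω) (ξ ω)‖ ^ 2 ∂μ ≤ σ ^ 2 := by
  set x' : Ω → C := fun ω => ⟨x ω, hxC ω⟩
  have hx' : Measurable[m] x' := hx.subtype_mk
  have hpair : Measurable fun ω => (x' ω, ξ ω) := (hx'.mono hm le_rfl).prodMk hξ
  have hmap := map_prodMk_eq_of_indep hm hξ hind hx'
  rw [hlaw] at hmap
  have hmeas : Measurable fun ω => e (x ω) (ξ ω) := he.comp hpair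
  have : IsProbabilityMeasure (μ.map x') :=
    Measure.isProbabilityMeasure_map (hx'.mono hm le_rfl).aemeasurable
  have hsq : Measurable fun p : C × Ξ => ENNReal.ofReal (‖e p.1 p.2‖ ^ 2) :=
    (he.norm.pow_const 2).ennreal_ofReal
  have hl : ∫⁻ ω, ENNReal.ofReal (‖e (x ω) (ξ ω)‖ ^ 2) ∂μ ≤ ENNReal.ofReal (σ ^ 2) := by
    calc ∫⁻ ω, ENNReal.ofReal (‖e (x ω) (ξ ω)‖ ^ 2) ∂μ
        = ∫⁻ p, ENNReal.ofReal (‖e p.1 p.2‖ ^ 2) ∂(μ.map fun ω => (x' ω, ξ ω)) :=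
          (lintegral_map hsq hpair).symm
      _ = ∫⁻ c, ∫⁻ s, ENNReal.ofReal (‖e (c : Vec d) s‖ ^ 2) ∂D ∂(μ.map x') := by
          rw [hmap, lintegral_prod _ hsq.aemeasurable]
      _ ≤ ∫⁻ _, ENNReal.ofReal (σ ^ 2) ∂(μ.map x') := by
          refine lintegral_mono fun c => ?_
          obtain ⟨h1, h2⟩ := hvar c c.2
          rw [← ofReal_integral_eq_lintegral_ofReal h1
            (Filter.Eventually.of_forall fun _ => sq_nonneg _)]
          exact ENNReal.ofReal_le_ofReal h2
      _ = _ := by simp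
  have hint : Integrable (fun ω => ‖e (x ω) (ξ ω)‖ ^ 2) μ := by
    refine ⟨(hmeas.norm.pow_const 2).aestronglyMeasurable, ?_⟩
    rw [hasFiniteIntegral_iff_ofReal (Filter.Eventually.of_forall fun _ => sq_nonneg _)]
    exact hl.trans_lt ENNReal.ofReal_lt_top
  refine ⟨(memLp_two_iff_integrable_sq_norm hmeas.aestronglyMeasurable).2 hint, ?_⟩
  rw [integral_eq_lintegral_of_nonneg_ae (Filter.Eventually.of_forall fun _ => sq_nonneg _)
    hint.aestronglyMeasurable]
  exact ENNReal.toReal_le_of_le_ofReal (sq_nonneg _) hl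

/-- Fubini with `x` and `A` frozen together: the inner integral over the sample is the pairing of
`A` with a zero mean. -/
theorem integral_inner_noise_eq_zero (hm : m ≤ mΩ) (hξ : Measurable ξ) (hlaw : μ.map ξ = D)
    (hind : Indep m (MeasurableSpace.comap ξ inferInstance) μ)
    (he : Measurable fun p : C × Ξ => e p.1 p.2)
    (hmean : ∀ x ∈ C, Integrable (e x) D ∧ ∫ s, e x s ∂D = 0)
    (hxC : ∀ ω, x ω ∈ C) (hx : Measurable[m] x)
    (hL2 : MemLp (fun ω => e (x ω) (ξ ω)) 2 μ) {A : Ω → Vec d} (hA : SqIntegrable m μ A) :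
    ∫ ω, inner ℝ (A ω) (e (x ω) (ξ ω)) ∂μ = 0 := by
  set Z : Ω → C × Vec d := fun ω => (⟨x ω, hxC ω⟩, A ω)
  have hZ : Measurable[m] Z := (hx.subtype_mk (h := hxC)).prodMk hA.measurable
  have hpair : Measurable fun ω => (Z ω, ξ ω) := (hZ.mono hm le_rfl).prodMk hξ
  have hmap := map_prodMk_eq_of_indep hm hξ hind hZ
  rw [hlaw] at hmap
  have : IsProbabilityMeasure (μ.map Z) :=
    Measure.isProbabilityMeasure_map (hZ.mono hm le_rfl).aemeasurable
  set k : (C × Vec d) × Ξ → ℝ := fun p => inner ℝ p.1.2 (e p.1.1 p.2) with hk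
  have hkm : Measurable k :=
    (measurable_snd.comp measurable_fst).inner
      (he.comp ((measurable_fst.comp measurable_fst).prodMk measurable_snd))
  have hki : Integrable k (μ.map fun ω => (Z ω, ξ ω)) := by
    rw [integrable_map_measure hkm.aestronglyMeasurable hpair.aemeasurable]
    exact integrable_inner_of_memLp hA.memLp hL2
  calc ∫ ω, inner ℝ (A ω) (e (x ω) (ξ ω)) ∂μ = ∫ p, k p ∂(μ.map fun ω => (Z ω, ξ ω)) :=
        (integral_map hpair.aemeasurable hkm.aestronglyMeasurable).symm
    _ = ∫ z, ∫ s, k (z, s) ∂D ∂(μ.map Z) := by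
        rw [hmap] at hki ⊢
        exact integral_prod _ hki
    _ = 0 := by
        refine integral_eq_zero_of_ae (Filter.Eventually.of_forall fun z => ?_)
        obtain ⟨h1, h2⟩ := hmean z.1 z.1.2
        simp only [hk, Pi.zero_apply]
        rw [integral_inner h1, h2, inner_zero_right]

end Noise

/-! ### The algorithm as a stochastic process. -/

section Sampled

variable {d n : ℕ} {Ξ : Fin n → Type*} [∀ i, MeasurableSpace (Ξ i)] {Ω : Type*}
  {mΩ : MeasurableSpace Ω}

/-- A composite problem together with unbiased stochastic gradients of bounded variance, a
regularizer `r` whose proximal mapping is that of `h`, a mixing matrix and independent samples. -/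
structure SampledProblem (F : ∀ i, Vec d → Ξ i → ℝ) (r : Vec d → EReal)
    (W : Matrix (Fin n) (Fin n) ℝ) (D : ∀ i, Measure (Ξ i)) (μ : Measure Ω)
    (ξ : ∀ i, ℕ → Ω → Ξ i) (C : Set (Vec d)) (h f : Vec d → ℝ) (G : Fin n → Vec d → Vec d)
    (L lam η : ℝ) (P : Vec d → Vec d) (σ : ℝ) : Prop
    extends CompositeProblem n C h f G L lam η P where
  prox_r : ∀ x, IsProx C h η x (prox r η x)
  mixing : W ∈ doublyStochastic ℝ (Fin n)
  spectral : specNorm (W - avgMat n) < 1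
  prob : ∀ i, IsProbabilityMeasure (D i)
  grad_measurable : ∀ i, Measurable fun p : C × Ξ i => stochGrad F i p.1 p.2
  unbiased : ∀ i, ∀ x ∈ C, Integrable (stochGrad F i x) (D i) ∧
    ∫ s, stochGrad F i x s ∂(D i) = G i x
  variance : ∀ i, ∀ x ∈ C, Integrable (fun s => ‖stochGrad F i x s - G i x‖ ^ 2) (D i) ∧
    ∫ s, ‖stochGrad F i x s - G i x‖ ^ 2 ∂(D i) ≤ σ ^ 2
  sample_measurable : ∀ i t, Measurable (ξ i t)
  sample_law : ∀ i t, μ.map (ξ i t) = D i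
  sample_indep : iIndepFun (fun p : Fin n × ℕ => ξ p.1 p.2) μ

/-- The σ-algebra generated by all samples other than `ξ i t`. -/
@[reducible] def otherSamples (ξ : ∀ i, ℕ → Ω → Ξ i) (i : Fin n) (t : ℕ) : MeasurableSpace Ω :=
  ⨆ p ∈ {p : Fin n × ℕ | p ≠ (i, t)}, MeasurableSpace.comap (ξ p.1 p.2) inferInstance

/-- The states of the algorithm as random variables. -/
noncomputable def state (F : ∀ i, Vec d → Ξ i → ℝ) (r : Vec d → EReal)
    (W : Matrix (Fin n) (Fin n) ℝ) (η : ℝ) (x0 : Vec d) (ξ : ∀ i, ℕ → Ω → Ξ i) (t : ℕ) (ω : Ω) :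
    State d n := run F r W η x0 (fun i t => ξ i t ω) t

/-- The gradient noise at the point `x`. -/
noncomputable def gradNoise (F : ∀ i, Vec d → Ξ i → ℝ)
    (G : Fin n → Vec d → Vec d) (i : Fin n) (x : Vec d) (s : Ξ i) : Vec d :=
  stochGrad F i x s - G i x

/-- The noise at iteration `t`. -/
noncomputable def noise (F : ∀ i, Vec d → Ξ i → ℝ) (r : Vec d → EReal)
    (W : Matrix (Fin n) (Fin n) ℝ) (η : ℝ) (x0 : Vec d) (ξ : ∀ i, ℕ → Ω → Ξ i)
    (G : Fin n → Vec d → Vec d) (t : ℕ) (ω : Ω) : Cols d n :=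
  fun i => gradNoise F G i ((state F r W η x0 ξ t ω).x i) (ξ i t ω)

variable {F : ∀ i, Vec d → Ξ i → ℝ} {r : Vec d → EReal} {W : Matrix (Fin n) (Fin n) ℝ}
  {D : ∀ i, Measure (Ξ i)} {μ : Measure Ω} {ξ : ∀ i, ℕ → Ω → Ξ i}
  {C : Set (Vec d)} {h f : Vec d → ℝ} {G : Fin n → Vec d → Vec d} {L lam η : ℝ}
  {P : Vec d → Vec d} {σ : ℝ} {x0 : Vec d}

namespace SampledProblem

lemma run_mem (S : SampledProblem F r W D μ ξ C h f G L lam η P σ) (hx0 : x0 ∈ C)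
    (s : ∀ i, ℕ → Ξ i) (t : ℕ) (i : Fin n) : (run F r W η x0 s t).x i ∈ C := by
  cases t with
  | zero => exact hx0
  | succ t => exact mulCols_mem S.mixing S.convex.convex (fun j => (S.prox_r _).1) i

lemma otherSamples_le (S : SampledProblem F r W D μ ξ C h f G L lam η P σ) (i : Fin n) (t : ℕ) :
    otherSamples ξ i t ≤ mΩ :=
  iSup₂_le fun p _ => (S.sample_measurable p.1 p.2).comap_le

lemma measurable_otherSamples {i j : Fin n} {t u : ℕ} (hu : u < t) :
    Measurable[otherSamples ξ i t] (ξ j u) := by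
  have hne : ((j, u) : Fin n × ℕ) ∈ {p : Fin n × ℕ | p ≠ (i, t)} := fun hc => by
    rw [Prod.mk.injEq] at hc; omega
  exact measurable_iff_comap_le.2 (le_iSup₂ (f := fun (p : Fin n × ℕ)
    (_ : p ∈ {p : Fin n × ℕ | p ≠ (i, t)}) =>
      MeasurableSpace.comap (ξ p.1 p.2) inferInstance) (j, u) hne)

lemma indep_otherSamples (S : SampledProblem F r W D μ ξ C h f G L lam η P σ) (i : Fin n)
    (t : ℕ) : Indep (otherSamples ξ i t) (MeasurableSpace.comap (ξ i t) inferInstance) μ := by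
  have := indep_iSup_of_disjoint (fun p : Fin n × ℕ => (S.sample_measurable p.1 p.2).comap_le)
    S.sample_indep.iIndep (S := {p | p ≠ (i, t)}) (T := {(i, t)})
    (Set.disjoint_left.2 fun p hp hq => hp hq)
  simpa [otherSamples] using this

lemma gradNoise_measurable (S : SampledProblem F r W D μ ξ C h f G L lam η P σ) (i : Fin n) :
    Measurable fun p : C × Ξ i => gradNoise F G i p.1 p.2 := by
  have h1 : Measurable (C.domRestrict (G i)) := by
    refine (LipschitzWith.of_dist_le' (K := L) fun x y => ?_).continuous.measurable
    rw [dist_eq_norm, Subtype.dist_eq, dist_eq_norm]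
    exact S.lipschitz i x x.2 y y.2
  exact (S.grad_measurable i).sub (h1.comp measurable_fst)

lemma gradNoise_mean (S : SampledProblem F r W D μ ξ C h f G L lam η P σ) (i : Fin n)
    (x : Vec d) (hx : x ∈ C) :
    Integrable (gradNoise F G i x) (D i) ∧ ∫ s, gradNoise F G i x s ∂(D i) = 0 := by
  have := S.prob i
  obtain ⟨h1, h2⟩ := S.unbiased i x hx
  refine ⟨h1.sub (integrable_const _), ?_⟩
  simp only [gradNoise]
  rw [integral_sub h1 (integrable_const _), h2]
  simp

variable [IsProbabilityMeasure μ]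

/-- The state at iteration `t` is square-integrable and a function of the previous samples. -/
theorem state_sqIntegrable (S : SampledProblem F r W D μ ξ C h f G L lam η P σ) (hx0 : x0 ∈ C)
    (t : ℕ) : ∀ m : MeasurableSpace Ω, m ≤ mΩ → (∀ j u, u < t → Measurable[m] (ξ j u)) →
      ∀ i, SqIntegrable m μ (fun ω => (state F r W η x0 ξ t ω).x i) ∧
        SqIntegrable m μ (fun ω => (state F r W η x0 ξ t ω).y i) ∧
        SqIntegrable m μ (fun ω => (state F r W η x0 ξ t ω).g i) := by
  -- Two σ-algebras are needed in the step: the new gradient is measurable for `m`, which may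
  -- contain `ξ i t`, whereas its square integrability rests on the old state being measurable for
  -- `otherSamples ξ i t`. Hence the induction over all `m`.
  induction t with
  | zero => exact fun m hm _ i => ⟨.const _, .const _, .const _⟩
  | succ t ih =>
    intro m hm hmeas
    have hx := fun i => (ih m hm (fun j u hu => hmeas j u (hu.trans (Nat.lt_succ_self t))) i).1
    have hy := fun i => (ih m hm (fun j u hu => hmeas j u (hu.trans (Nat.lt_succ_self t))) i).2.1
    have hg := fun i => (ih m hm (fun j u hu => hmeas j u (hu.trans (Nat.lt_succ_self t))) i).2.2
    have hg' : ∀ i, SqIntegrable m μ (fun ω => (state F r W η x0 ξ (t + 1) ω).g i) := by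
      intro i
      have hmeasg : Measurable[m] (fun ω => (state F r W η x0 ξ (t + 1) ω).g i) :=
        (S.grad_measurable i).comp (((hx i).measurable.subtype_mk
          (h := fun ω => S.run_mem hx0 _ t i)).prodMk (hmeas i t (Nat.lt_succ_self t)))
      refine ⟨hmeasg, ?_⟩
      have hpast := (ih (otherSamples ξ i t) (S.otherSamples_le i t)
        (fun j u hu => measurable_otherSamples hu) i).1
      have := S.prob i
      have hn := (memLp_noise (S.otherSamples_le i t) (S.sample_measurable i t)
        (S.sample_law i t) (S.indep_otherSamples i t) (S.gradNoise_measurable i) (S.variance i)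
        (fun ω => S.run_mem hx0 _ t i) hpast.measurable).1
      have hG := hpast.comp_lipschitzOn (S.otherSamples_le i t) (S.lipschitz i)
        (fun ω => S.run_mem hx0 _ t i)
      convert hn.add hG.memLp using 1
      funext ω
      exact (sub_add_cancel _ _).symm
    have hy' : ∀ i, SqIntegrable m μ (fun ω => (state F r W η x0 ξ (t + 1) ω).y i) := fun i =>
      SqIntegrable.mulCols (X := fun ω i => (state F r W η x0 ξ t ω).y i
        + (state F r W η x0 ξ (t + 1) ω).g i - (state F r W η x0 ξ t ω).g i)
        (fun i => ((hy i).add (hg' i)).sub (hg i)) W i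
    have hu : ∀ i, SqIntegrable m μ (fun ω => prox r η ((state F r W η x0 ξ t ω).x i
        - η • (state F r W η x0 ξ (t + 1) ω).y i)) := fun i =>
      ((hx i).sub ((hy' i).const_smul η)).comp_lipschitzOn hm (C := Set.univ) (c := 1)
        (fun a _ b _ => by
          have := (S.prox_r a).norm_sub_le S.convex S.eta_pos (S.prox_r b)
          rwa [mul_zero, sub_zero, one_mul, ← one_mul ‖a - b‖] at this)
        (fun _ => Set.mem_univ _)
    exact fun i => ⟨SqIntegrable.mulCols hu W i, hy' i, hg' i⟩

end SampledProblem

end Sampled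

/-! ### Expected one-step inequalities and the summed rate. -/

section Rate

variable {d n : ℕ} {Ξ : Fin n → Type*} [∀ i, MeasurableSpace (Ξ i)] {Ω : Type*}
  {mΩ : MeasurableSpace Ω} {F : ∀ i, Vec d → Ξ i → ℝ} {r : Vec d → EReal}
  {W : Matrix (Fin n) (Fin n) ℝ} {D : ∀ i, Measure (Ξ i)} {μ : Measure Ω}
  {ξ : ∀ i, ℕ → Ω → Ξ i} {C : Set (Vec d)} {h f : Vec d → ℝ} {G : Fin n → Vec d → Vec d}
  {L lam η : ℝ} {P : Vec d → Vec d} {σ : ℝ} {x0 : Vec d}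

lemma CompositeProblem.residual_sqIntegrable [IsFiniteMeasure μ]
    (S : CompositeProblem n C h f G L lam η P) {m : MeasurableSpace Ω} (hm : m ≤ mΩ)
    {x : Ω → Vec d} (hx : SqIntegrable m μ x) : SqIntegrable m μ fun ω => x ω - P (x ω) :=
  hx.sub (hx.comp_lipschitzOn hm (C := Set.univ) (fun a _ b _ => S.norm_P_sub_le a b)
    fun _ => Set.mem_univ _)

lemma CompositeProblem.descentDir_sqIntegrable [IsFiniteMeasure μ]
    (S : CompositeProblem n C h f G L lam η P) {m : MeasurableSpace Ω} (hm : m ≤ mΩ)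
    {x : Ω → Cols d n} (hx : ∀ i, SqIntegrable m μ fun ω => x ω i) (hxC : ∀ ω i, x ω i ∈ C) :
    SqIntegrable m μ fun ω => descentDir G lam η P (x ω) := by
  have hG : SqIntegrable m μ fun ω => avgCol fun j => G j (x ω j) :=
    SqIntegrable.avgCol (X := fun ω j => G j (x ω j)) fun j =>
      (hx j).comp_lipschitzOn hm (S.lipschitz j) fun ω => hxC ω j
  have hGP : ∀ i, SqIntegrable m μ fun ω => avgCol fun j => G j (P (x ω i)) := fun i =>
    ((hx i).comp_lipschitzOn hm (C := Set.univ) (fun a _ b _ => S.norm_P_sub_le a b)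
      fun _ => Set.mem_univ _).comp_lipschitzOn hm (K := fun p => avgCol fun j => G j p)
      (fun a ha b hb => S.norm_avgCol_sub_le ha hb) fun _ => (S.isProx _).1
  exact SqIntegrable.avgCol (X := fun ω i => (1 - η / lam) • (x ω i - P (x ω i))
    - η • ((avgCol fun j => G j (x ω j)) - avgCol fun j => G j (P (x ω i)))) fun i =>
    ((S.residual_sqIntegrable hm (hx i)).const_smul _).sub ((hG.sub (hGP i)).const_smul η)

/-- The part of the consensus error of the tracked gradients after iteration `t` that does not
depend on the samples of that iteration. -/
noncomputable def predictable (W : Matrix (Fin n) (Fin n) ℝ) (G : Fin n → Vec d → Vec d)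
    (s : State d n) : Cols d n :=
  mulCols (fun i => s.y i + G i (s.x i) - s.g i) (W - avgMat n)

namespace SampledProblem

/-- The tracker lags by one index: the state at `t + 1` holds the direction and the stochastic
gradients computed in iteration `t`. -/
lemma state_succ_y (t : ℕ) (ω : Ω) : (state F r W η x0 ξ (t + 1) ω).y =
    mulCols (fun i => (state F r W η x0 ξ t ω).y i + (state F r W η x0 ξ (t + 1) ω).g i
      - (state F r W η x0 ξ t ω).g i) W := rfl

lemma state_succ_g (t : ℕ) (ω : Ω) (i : Fin n) : (state F r W η x0 ξ (t + 1) ω).g i =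
    G i ((state F r W η x0 ξ t ω).x i) + noise F r W η x0 ξ G t ω i :=
  (add_sub_cancel _ _).symm

/-- The invariant of gradient tracking: mixing preserves averages, the corrections telescope, and
both sides start at zero. -/
lemma avgCol_state_y (S : SampledProblem F r W D μ ξ C h f G L lam η P σ) (t : ℕ) (ω : Ω) :
    avgCol (state F r W η x0 ξ t ω).y = avgCol (state F r W η x0 ξ t ω).g := by
  induction t with
  | zero => rfl
  | succ t ih =>
    rw [state_succ_y, avgCol_mulCols S.mixing]
    have : (fun i => (state F r W η x0 ξ t ω).y i + (state F r W η x0 ξ (t + 1) ω).g i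
      - (state F r W η x0 ξ t ω).g i) = (state F r W η x0 ξ t ω).y
        + (state F r W η x0 ξ (t + 1) ω).g - (state F r W η x0 ξ t ω).g := rfl
    rw [this, avgCol_sub, avgCol_add, ih]
    abel

lemma perp_state_succ_y (S : SampledProblem F r W D μ ξ C h f G L lam η P σ) (t : ℕ) (ω : Ω) :
    perp (state F r W η x0 ξ (t + 1) ω).y = predictable W G (state F r W η x0 ξ t ω)
      + mulCols (noise F r W η x0 ξ G t ω) (W - avgMat n) := by
  rw [state_succ_y, perp_mulCols S.mixing, predictable, ← mulCols_add]
  congr 1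
  funext i
  rw [state_succ_g (G := G), Pi.add_apply]
  abel

/-- The stored stochastic gradient is removed together with its noise, leaving the change of the
true gradients. The direction `y` may be replaced by its consensus error because `W - avgMat n`
ignores averages. -/
lemma predictable_succ (S : SampledProblem F r W D μ ξ C h f G L lam η P σ) (t : ℕ) (ω : Ω) :
    predictable W G (state F r W η x0 ξ (t + 1) ω) =
      mulCols (predictable W G (state F r W η x0 ξ t ω)
        + mulCols (noise F r W η x0 ξ G t ω) (W - avgMat n) - noise F r W η x0 ξ G t ω
        + fun i => G i ((state F r W η x0 ξ (t + 1) ω).x i)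
          - G i ((state F r W η x0 ξ t ω).x i)) (W - avgMat n) := by
  rw [← S.perp_state_succ_y, mulCols_add, mulCols_sub, mulCols_perp S.pos S.mixing, ← mulCols_sub,
    ← mulCols_add, predictable]
  congr 1
  funext i
  rw [state_succ_g (G := G)]
  simp only [Pi.add_apply, Pi.sub_apply]
  abel

variable [IsProbabilityMeasure μ]

lemma noise_memLp (S : SampledProblem F r W D μ ξ C h f G L lam η P σ) (hx0 : x0 ∈ C) (t : ℕ)
    (i : Fin n) : MemLp (fun ω => noise F r W η x0 ξ G t ω i) 2 μ ∧
      ∫ ω, ‖noise F r W η x0 ξ G t ω i‖ ^ 2 ∂μ ≤ σ ^ 2 := by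
  have := S.prob i
  exact memLp_noise (S.otherSamples_le i t) (S.sample_measurable i t) (S.sample_law i t)
    (S.indep_otherSamples i t) (S.gradNoise_measurable i) (S.variance i)
    (fun ω => S.run_mem hx0 _ t i) (S.state_sqIntegrable hx0 t _ (S.otherSamples_le i t)
      (fun j u hu => measurable_otherSamples hu) i).1.measurable

lemma integrable_inner_noise (S : SampledProblem F r W D μ ξ C h f G L lam η P σ)
    (hx0 : x0 ∈ C) (t : ℕ) {A : Ω → Cols d n}
    (hA : ∀ i, SqIntegrable (otherSamples ξ i t) μ fun ω => A ω i) :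
    Integrable (fun ω => ∑ i, inner ℝ (A ω i) (noise F r W η x0 ξ G t ω i)) μ :=
  integrable_finsetSum _ fun i _ =>
    integrable_inner_of_memLp (hA i).memLp (S.noise_memLp hx0 t i).1

lemma integral_inner_noise (S : SampledProblem F r W D μ ξ C h f G L lam η P σ)
    (hx0 : x0 ∈ C) (t : ℕ) {A : Ω → Cols d n}
    (hA : ∀ i, SqIntegrable (otherSamples ξ i t) μ fun ω => A ω i) :
    ∫ ω, ∑ i, inner ℝ (A ω i) (noise F r W η x0 ξ G t ω i) ∂μ = 0 := by
  rw [integral_finsetSum _ fun i _ =>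
    integrable_inner_of_memLp (hA i).memLp (S.noise_memLp hx0 t i).1]
  refine Finset.sum_eq_zero fun i _ => ?_
  have := S.prob i
  exact integral_inner_noise_eq_zero (S.otherSamples_le i t) (S.sample_measurable i t)
    (S.sample_law i t) (S.indep_otherSamples i t) (S.gradNoise_measurable i)
    (S.gradNoise_mean i) (fun ω => S.run_mem hx0 _ t i)
    (S.state_sqIntegrable hx0 t _ (S.otherSamples_le i t)
      (fun j u hu => measurable_otherSamples hu) i).1.measurable
    (S.noise_memLp hx0 t i).1 (hA i)

lemma predictable_sqIntegrable (S : SampledProblem F r W D μ ξ C h f G L lam η P σ)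
    (hx0 : x0 ∈ C) (t : ℕ) {m : MeasurableSpace Ω} (hm : m ≤ mΩ)
    (hmeas : ∀ j u, u < t → Measurable[m] (ξ j u)) (i : Fin n) :
    SqIntegrable m μ fun ω => predictable W G (state F r W η x0 ξ t ω) i :=
  SqIntegrable.mulCols (X := fun ω i => (state F r W η x0 ξ t ω).y i
      + G i ((state F r W η x0 ξ t ω).x i) - (state F r W η x0 ξ t ω).g i) (fun j =>
    have hj := S.state_sqIntegrable hx0 t m hm hmeas j
    (hj.2.1.add (hj.1.comp_lipschitzOn hm (S.lipschitz j)
      fun ω => S.run_mem hx0 _ t j)).sub hj.2.2) _ i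

/-- The envelope lies between the constant `b` and the quadratic obtained by testing with `x0`. -/
lemma integrable_proxValue (S : SampledProblem F r W D μ ξ C h f G L lam η P σ) (hx0 : x0 ∈ C)
    {b : ℝ} (hb : ∀ x, b ≤ proxValue (fun x => f x + h x) lam P x) {x : Ω → Vec d}
    (hx : SqIntegrable mΩ μ x) :
    Integrable (fun ω => proxValue (fun x => f x + h x) lam P (x ω)) μ := by
  have hcont : Continuous (proxValue (fun x => f x + h x) lam P) :=
    continuous_iff_continuousAt.2 fun y =>
      (hasGradientAt_proxValue S.weaklyConvex S.lam_pos (by linarith [S.lam_mul_le])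
        S.isProx y).differentiableAt.continuousAt
  have hsq := ((SqIntegrable.const x0).sub hx).integrable_sq
  refine ((integrable_const (|b| + |f x0 + h x0|)).add
    (hsq.const_mul (1 / (2 * lam)))).mono'
    (hcont.measurable.comp hx.measurable).aestronglyMeasurable
    (Filter.Eventually.of_forall fun ω => ?_)
  have h1 := hb (x ω)
  have h2 : proxValue (fun x => f x + h x) lam P (x ω) ≤ _ := (S.isProx (x ω)).2 x0 hx0
  have h3 : 0 ≤ 1 / (2 * lam) * ‖x0 - x ω‖ ^ 2 := by have := S.lam_pos; positivity
  rw [Real.norm_eq_abs, abs_le]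
  simp only [Pi.add_apply]
  constructor
  · linarith [neg_abs_le b, abs_nonneg (f x0 + h x0)]
  · linarith [le_abs_self (f x0 + h x0), abs_nonneg b]

/-- The convergence rate, summed over the iterations. -/
theorem sum_integral_le (S : SampledProblem F r W D μ ξ C h f G L lam η P σ) (hx0 : x0 ∈ C)
    (T : ℕ) {b : ℝ} (hb : ∀ x, b ≤ proxValue (fun x => f x + h x) lam P x)
    (h1 : specNorm (W - avgMat n) * η * L ≤ (1 - specNorm (W - avgMat n) ^ 2) ^ 4 / 96)
    (h2 : specNorm (W - avgMat n) * lam * L ≤ 1 / 96) :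
    ∑ t ∈ Finset.range T, (1 / lam ^ 2 *
        (∫ ω, ∑ i, ‖(state F r W η x0 ξ t ω).x i - P ((state F r W η x0 ξ t ω).x i)‖ ^ 2 ∂μ)
        + 4 / (lam * η) * ∫ ω, frobSq (perp (state F r W η x0 ξ t ω).x) ∂μ)
      ≤ 8 * (n * proxValue (fun x => f x + h x) lam P x0 - n * b) / η
        + 4616 * η / (lam * (1 - specNorm (W - avgMat n) ^ 2) ^ 3) * (n * σ ^ 2 * T)
        + 768 * η / (lam * (1 - specNorm (W - avgMat n) ^ 2) ^ 3)
          * ∫ ω, frobSq (perp fun i => stochGrad F i x0 (ξ i 0 ω)) ∂μ := by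
  set φ : Vec d → ℝ := fun x => f x + h x with hφ
  set R := W - avgMat n with hR
  set st := state F r W η x0 ξ with hst
  set e := noise F r W η x0 ξ G with he
  set u : ℕ → Ω → Cols d n := fun t ω i => prox r η ((st t ω).x i - η • (st (t + 1) ω).y i)
    with hu
  set p : ℕ → Ω → Cols d n := fun t ω i => P ((st t ω).x i) with hp
  have hxC : ∀ t ω i, (st t ω).x i ∈ C := fun t ω i => S.run_mem hx0 _ t i
  have hprox : ∀ t ω i, IsProx C h η ((st t ω).x i - η • (st (t + 1) ω).y i) (u t ω i) :=
    fun t ω i => S.prox_r _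
  -- square integrability
  have hL2 := fun t i => S.state_sqIntegrable hx0 t mΩ le_rfl
    (fun j u _ => S.sample_measurable j u) i
  have hxL : ∀ t i, SqIntegrable mΩ μ fun ω => (st t ω).x i := fun t i => (hL2 t i).1
  have hyL : ∀ t i, SqIntegrable mΩ μ fun ω => (st t ω).y i := fun t i => (hL2 t i).2.1
  have hgL : ∀ t i, SqIntegrable mΩ μ fun ω => (st t ω).g i := fun t i => (hL2 t i).2.2
  have hrL : ∀ t i, SqIntegrable mΩ μ fun ω => (st t ω).x i - p t ω i := fun t i =>
    S.residual_sqIntegrable le_rfl (hxL t i)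
  have hpL : ∀ t i, SqIntegrable mΩ μ fun ω => p t ω i := fun t i =>
    (hxL t i).comp_lipschitzOn le_rfl (C := Set.univ) (fun a _ b _ => S.norm_P_sub_le a b)
      fun _ => Set.mem_univ _
  have huL : ∀ t i, SqIntegrable mΩ μ fun ω => u t ω i := fun t i =>
    ((hxL t i).sub ((hyL (t + 1) i).const_smul η)).comp_lipschitzOn le_rfl (C := Set.univ)
      (c := 1) (fun a _ b _ => by
        have := (S.prox_r a).norm_sub_le S.convex S.eta_pos (S.prox_r b)
        rwa [mul_zero, sub_zero, one_mul, ← one_mul ‖a - b‖] at this)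
      fun _ => Set.mem_univ _
  have iD : ∀ t, Integrable (fun ω => ∑ i, ‖(st t ω).x i - p t ω i‖ ^ 2) μ := fun t =>
    SqIntegrable.integrable_frobSq (X := fun ω i => (st t ω).x i - p t ω i) (hrL t)
  have iB : ∀ t, Integrable (fun ω => ∑ i, ‖u t ω i - p t ω i‖ ^ 2) μ := fun t =>
    SqIntegrable.integrable_frobSq (X := fun ω i => u t ω i - p t ω i)
      fun i => (huL t i).sub (hpL t i)
  have iX : ∀ t, Integrable (fun ω => frobSq (perp (st t ω).x)) μ := fun t =>
    SqIntegrable.integrable_frobSq fun i => SqIntegrable.perp (hxL t) i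
  have iY : ∀ t, Integrable (fun ω => frobSq (perp (st t ω).y)) μ := fun t =>
    SqIntegrable.integrable_frobSq fun i => SqIntegrable.perp (hyL t) i
  have iZ : ∀ t, Integrable (fun ω => frobSq (predictable W G (st t ω))) μ := fun t =>
    SqIntegrable.integrable_frobSq fun i => S.predictable_sqIntegrable hx0 t le_rfl
      (fun j u _ => S.sample_measurable j u) i
  have iV : ∀ t, Integrable (fun ω => frobSq ((st (t + 1) ω).x - (st t ω).x)) μ := fun t =>
    SqIntegrable.integrable_frobSq fun i => (hxL (t + 1) i).sub (hxL t i)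
  have iΦ : ∀ t, Integrable (fun ω => ∑ i, proxValue φ lam P ((st t ω).x i)) μ := fun t =>
    integrable_finsetSum _ fun i _ => S.integrable_proxValue hx0 hb (hxL t i)
  have ie : ∀ t, Integrable (fun ω => frobSq (e t ω)) μ := fun t =>
    integrable_finsetSum _ fun i _ => (S.noise_memLp hx0 t i).1.integrable_norm_pow (by norm_num)
  have i0 : Integrable (fun _ : Ω => (0 : ℝ)) μ := integrable_zero _ _ _
  have hQ : ∀ t, ∫ ω, frobSq (e t ω) ∂μ ≤ n * σ ^ 2 := by
    intro t
    simp only [frobSq]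
    rw [integral_finsetSum _ fun i _ =>
      (S.noise_memLp hx0 t i).1.integrable_norm_pow (by norm_num)]
    calc _ ≤ ∑ i : Fin n, σ ^ 2 := Finset.sum_le_sum fun i _ => (S.noise_memLp hx0 t i).2
      _ = n * σ ^ 2 := by simp
  -- the predictable directions correlated with the noise
  have hdir : ∀ t i, SqIntegrable (otherSamples ξ i t) μ
      fun ω => CompositeProblem.descentDir G lam η P (st t ω).x := fun t i =>
    S.descentDir_sqIntegrable (S.otherSamples_le i t) (x := fun ω => (st t ω).x)
      (fun j => (S.state_sqIntegrable hx0 t _ (S.otherSamples_le i t)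
        (fun j u hu => measurable_otherSamples hu) j).1) (hxC t)
  have hpred : ∀ t (A : Matrix (Fin n) (Fin n) ℝ) i, SqIntegrable (otherSamples ξ i t) μ
      fun ω => mulCols (predictable W G (st t ω)) A i := fun t A i =>
    SqIntegrable.mulCols (fun j => S.predictable_sqIntegrable hx0 t (S.otherSamples_le i t)
      (fun j u hu => measurable_otherSamples hu) j) A i
  -- `Y` is read off the state at `t + 1`, which holds the direction used in iteration `t`.
  refine (sum_le_of_one_step (ρ := specNorm R) (L := L) (N := n * σ ^ 2)
    (Φ := fun t => ∫ ω, ∑ i, proxValue φ lam P ((st t ω).x i) ∂μ)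
    (D := fun t => ∫ ω, ∑ i, ‖(st t ω).x i - p t ω i‖ ^ 2 ∂μ)
    (X := fun t => ∫ ω, frobSq (perp (st t ω).x) ∂μ)
    (Y := fun t => ∫ ω, frobSq (perp (st (t + 1) ω).y) ∂μ)
    (Z := fun t => ∫ ω, frobSq (predictable W G (st t ω)) ∂μ)
    (B := fun t => ∫ ω, ∑ i, ‖u t ω i - p t ω i‖ ^ 2 ∂μ)
    (V := fun t => ∫ ω, frobSq ((st (t + 1) ω).x - (st t ω).x) ∂μ)
    (G0 := ∫ ω, frobSq (perp fun i => stochGrad F i x0 (ξ i 0 ω)) ∂μ) (Φinf := n * b) T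
    (norm_nonneg _) S.spectral S.L_nonneg S.lam_pos S.eta_pos (by positivity)
    (integral_nonneg fun ω => frobSq_nonneg _) h1 h2
    (fun t => integral_nonneg fun ω => Finset.sum_nonneg fun i _ => sq_nonneg _)
    (fun t => integral_nonneg fun ω => frobSq_nonneg _)
    (fun t => integral_nonneg fun ω => frobSq_nonneg _)
    (fun t => integral_nonneg fun ω => frobSq_nonneg _)
    ?_ ?_ ?_ ?_ ?_ ?_ ?_ ?_ ?_).trans (le_of_eq ?_)
  · intro t
    have := integral_le_of_le_linear_combination (c₁ := 1) (c₂ := -(1 / (2 * lam)))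
      (c₃ := 2 / (9 * lam)) (c₄ := 1 / (2 * lam)) (c₅ := 0)
      (iΦ (t + 1)) (iΦ t) (iD t) (iX t) (iB t) i0 (fun ω => by
        have := S.sum_proxValue_mulCols_le S.mixing (st t ω).x (u t ω)
        have e1 : (st (t + 1) ω).x = mulCols (u t ω) W := rfl
        rw [e1]
        linarith)
    linarith
  · intro t
    have := integral_le_of_le_linear_combination (c₁ := 1 - 3 * η / (4 * lam)) (c₂ := 7 / 6)
      (c₃ := 2 * η ^ 2) (c₄ := η ^ 2) (c₅ := -(2 * η))
      (iB t) (iD t) (iX t) (iY (t + 1)) (ie t) (S.integrable_inner_noise hx0 t (hdir t))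
      (fun ω => by
        have := S.sum_norm_prox_sub_sq_le (e := e t ω) (hxC t ω) (hprox t ω) (by
          rw [hst, S.avgCol_state_y]
          congr 1
          funext i
          exact state_succ_g t ω i)
        linarith)
    rw [S.integral_inner_noise hx0 t (hdir t)] at this
    have hq := mul_le_mul_of_nonneg_left (hQ t) (sq_nonneg η)
    linarith
  · have : ∀ ω, frobSq (perp (st 0 ω).x) = 0 := fun ω => by
      have hx : ∀ i, (st 0 ω).x i = x0 := fun _ => rfl
      refine le_antisymm ((frobSq_perp_le_sum S.pos _ x0).trans (le_of_eq ?_)) (frobSq_nonneg _)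
      simp [hx]
    simp [this]
  · intro t
    have := integral_le_of_le_linear_combination (c₁ := (1 + specNorm R ^ 2) / 2)
      (c₂ := 2 * specNorm R ^ 2 / (1 - specNorm R ^ 2) * η ^ 2) (c₃ := 0) (c₄ := 0) (c₅ := 0)
      (iX (t + 1)) (iX t) (iY (t + 1)) i0 i0 i0 (fun ω => by
        have := S.frobSq_perp_mulCols_prox_le S.mixing S.spectral (hprox t ω)
        have e1 : (st (t + 1) ω).x = mulCols (u t ω) W := rfl
        rw [e1]
        linarith)
    linarith
  · intro t
    have := integral_le_of_le_linear_combination (c₁ := 1) (c₂ := 2) (c₃ := 1) (c₄ := 0)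
      (c₅ := 0) (iY (t + 1)) (iZ t) (S.integrable_inner_noise hx0 t (hpred t R.transpose))
      (ie t) i0 i0 (fun ω => by
        have := frobSq_add_mulCols_le S.spectral (predictable W G (st t ω)) (e t ω)
        rw [hst, S.perp_state_succ_y]
        linarith)
    rw [S.integral_inner_noise hx0 t (hpred t R.transpose)] at this
    linarith [hQ t]
  -- Initially the predictable part comes from the true gradients at `x0`. Adding centred noise can
  -- only increase the expected consensus error, so the stochastic gradients dominate it.
  · have hG : ∀ ω, (fun i => stochGrad F i x0 (ξ i 0 ω)) = (fun i => G i x0) + e 0 ω := fun ω =>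
      funext fun i => state_succ_g 0 ω i
    have hA : ∀ i, SqIntegrable (otherSamples ξ i 0) μ fun _ =>
        mulCols (perp fun i => G i x0) (1 - avgMat n).transpose i := fun i => .const _
    have hgrad : Integrable (fun ω => frobSq (perp fun i => stochGrad F i x0 (ξ i 0 ω))) μ :=
      SqIntegrable.integrable_frobSq fun i => SqIntegrable.perp (hgL 1) i
    have := integral_le_of_le_linear_combination (c₁ := 1) (c₂ := -2) (c₃ := 0) (c₄ := 0)
      (c₅ := 0) (iZ 0) hgrad (S.integrable_inner_noise hx0 0 hA) i0 i0 i0 (fun ω => by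
        have e1 : predictable W G (st 0 ω) = mulCols (fun i => G i x0) R := by
          rw [predictable]
          congr 1
          funext i
          have : (0 : Vec d) + G i x0 - 0 = G i x0 := by rw [zero_add, sub_zero]
          exact this
        have a := frobSq_mulCols_sub_avgMat_le S.pos S.mixing (fun i => G i x0)
        have hρ0 : 0 ≤ specNorm R := norm_nonneg _
        have hρ1 : specNorm R < 1 := S.spectral
        have b : specNorm R ^ 2 * frobSq (perp fun i => G i x0)
            ≤ 1 * frobSq (perp fun i => G i x0) :=
          mul_le_mul_of_nonneg_right (by nlinarith) (frobSq_nonneg _)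
        have c := frobSq_add (perp fun i => G i x0) (perp (e 0 ω))
        rw [← perp_add, ← hG] at c
        have c2 := sum_inner_mulCols (perp fun i => G i x0) (e 0 ω) (1 - avgMat n)
        have c3 := frobSq_nonneg (perp (e 0 ω))
        change ∑ i, inner ℝ (perp (fun i => G i x0) i) (perp (e 0 ω) i) = _ at c2
        rw [c2] at c
        rw [e1]
        linarith)
    rw [S.integral_inner_noise hx0 0 hA] at this
    linarith
  · intro t
    have := integral_le_of_le_linear_combination (c₁ := (1 + specNorm R ^ 2) / 2)
      (c₂ := (1 + specNorm R ^ 2) / 2 * 2) (c₃ := (1 + specNorm R ^ 2) / 2 * 4)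
      (c₄ := 2 * specNorm R ^ 2 / (1 - specNorm R ^ 2) * L ^ 2) (c₅ := 0)
      (iZ (t + 1)) (iZ t) (S.integrable_inner_noise hx0 t (hpred t (R - 1).transpose))
      (ie t) (iV t) i0 (fun ω => by
        have a := frobSq_mulCols_tracking_le S.spectral (predictable W G (st t ω)) (e t ω)
          (fun i => G i ((st (t + 1) ω).x i) - G i ((st t ω).x i))
        have c : frobSq (fun i => G i ((st (t + 1) ω).x i) - G i ((st t ω).x i))
            ≤ L ^ 2 * frobSq ((st (t + 1) ω).x - (st t ω).x) := by
          rw [frobSq, frobSq, Finset.mul_sum]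
          refine Finset.sum_le_sum fun i _ => ?_
          rw [← mul_pow]
          exact pow_le_pow_left₀ (norm_nonneg _)
            (S.lipschitz i _ (hxC _ ω i) _ (hxC _ ω i)) 2
        have hρ : 0 ≤ 2 * specNorm R ^ 2 / (1 - specNorm R ^ 2) := by
          have h0 : 0 ≤ specNorm R := norm_nonneg _
          have h1 : specNorm R < 1 := S.spectral
          have : 0 < 1 - specNorm R ^ 2 := by nlinarith
          positivity
        have c' := mul_le_mul_of_nonneg_left c hρ
        rw [hst, S.predictable_succ]
        linarith)
    rw [S.integral_inner_noise hx0 t (hpred t (R - 1).transpose)] at this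
    have hq := mul_le_mul_of_nonneg_left (hQ t)
      (by positivity : 0 ≤ (1 + specNorm R ^ 2) / 2 * 4)
    linarith
  · intro t
    have := integral_le_of_le_linear_combination (c₁ := 3) (c₂ := 3) (c₃ := 12) (c₄ := 0)
      (c₅ := 0) (iV t) (iB t) (iD t) (iX t) i0 i0 (fun ω => by
        have := frobSq_mulCols_sub_le S.mixing (st t ω).x (p t ω) (u t ω)
        have e1 : (st (t + 1) ω).x = mulCols (u t ω) W := rfl
        rw [e1]
        simp only [frobSq, Pi.sub_apply] at this ⊢
        linarith)
    linarith
  · have := integral_mono (μ := μ) (integrable_const (n * b)) (iΦ T) (fun ω => by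
      calc n * b = ∑ i : Fin n, b := by simp
        _ ≤ _ := Finset.sum_le_sum fun i _ => hb _)
    simpa using this
  · have : ∀ ω i, (st 0 ω).x i = x0 := fun _ _ => rfl
    simp [this]

end SampledProblem

end Rate

/-! ### Expectation at an independent uniform index. -/

section RandomIndex

variable {Ω : Type*} {m mΩ : MeasurableSpace Ω} {μ : Measure Ω}

/-- The expectation of a process at an independent uniform time. -/
theorem integral_uniform_index [IsProbabilityMeasure μ] {T : ℕ} {τ : Ω → Fin T}
    (hτ : Measurable τ) (hunif : ∀ t : Fin T, μ (τ ⁻¹' {t}) = (T : ENNReal)⁻¹)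
    (hind : Indep (MeasurableSpace.comap τ inferInstance) m μ) {g : ℕ → Ω → ℝ}
    (hgm : ∀ t, Measurable[m] (g t)) (hgi : ∀ t, Integrable (g t) μ) :
    Integrable (fun ω => g (τ ω) ω) μ ∧
      ∫ ω, g (τ ω) ω ∂μ = 1 / (T : ℝ) * ∑ t ∈ Finset.range T, ∫ ω, g t ω ∂μ := by
  have hset : ∀ t, MeasurableSet (τ ⁻¹' {t}) := fun t => hτ (measurableSet_singleton t)
  have hdec : (fun ω => g (τ ω) ω) = fun ω => ∑ t : Fin T, (τ ⁻¹' {t}).indicator (g t) ω := by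
    funext ω
    rw [Finset.sum_eq_single (τ ω)]
    · rw [Set.indicator_of_mem (by simp)]
    · intro t _ ht
      exact Set.indicator_of_notMem (fun hc => ht hc.symm) _
    · simp
  have hi : ∀ t : Fin T, Integrable ((τ ⁻¹' {t}).indicator (g t)) μ := fun t =>
    (hgi t).indicator (hset t)
  have hint : ∀ t : Fin T, ∫ ω, (τ ⁻¹' {t}).indicator (g t) ω ∂μ
      = 1 / (T : ℝ) * ∫ ω, g t ω ∂μ := by
    intro t
    have hI : IndepFun ((τ ⁻¹' {t}).indicator fun _ => (1 : ℝ)) (g t) μ := by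
      rw [IndepFun_iff_Indep]
      refine indep_of_indep_of_le hind ?_ (hgm t).comap_le
      refine Measurable.comap_le ?_
      exact measurable_const.indicator ⟨{t}, measurableSet_singleton t, rfl⟩
    have e : (τ ⁻¹' {t}).indicator (g t)
        = ((τ ⁻¹' {t}).indicator fun _ => (1 : ℝ)) * g t := by
      funext ω
      by_cases hω : ω ∈ τ ⁻¹' {t} <;> simp [hω]
    rw [e, hI.integral_mul_eq_mul_integral
      (measurable_const.indicator (hset t)).aestronglyMeasurable
      (hgi t).aestronglyMeasurable, integral_indicator_const _ (hset t), Measure.real, hunif t]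
    simp
  rw [hdec]
  refine ⟨integrable_finsetSum _ fun t _ => hi t, ?_⟩
  rw [integral_finsetSum _ fun t _ => hi t, Finset.mul_sum, Finset.sum_congr rfl fun t _ => hint t,
    Finset.sum_range]

end RandomIndex

/-! ### Consequences of the parameter choices. -/

section Parameters

lemma lamChoice_spec {L ρ : ℝ} (hL : 0 < L) (hρ : 0 ≤ ρ) :
    0 < lamChoice L ρ ∧ lamChoice L ρ * L ≤ 1 / 4 ∧ ρ * lamChoice L ρ * L ≤ 1 / 96 := by
  rw [lamChoice]
  split_ifs with h
  · subst h
    refine ⟨by positivity, le_of_eq (by field_simp), by simp⟩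
  · have hρ' : 0 < ρ := lt_of_le_of_ne hρ (Ne.symm h)
    have a := min_le_left (1 / (4 * L)) (1 / (96 * ρ * L))
    have b := min_le_right (1 / (4 * L)) (1 / (96 * ρ * L))
    rw [le_div_iff₀ (by positivity)] at a b
    exact ⟨by positivity, by linarith, by linarith⟩

lemma etaMax_spec {L ρ η : ℝ} (hL : 0 < L) (hρ : 0 ≤ ρ) (hρ1 : ρ < 1) (hη : η ≤ etaMax L ρ) :
    η ≤ lamChoice L ρ ∧ ρ * η * L ≤ (1 - ρ ^ 2) ^ 4 / 96 := by
  rw [etaMax] at hη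
  rw [lamChoice]
  split_ifs at hη ⊢ with h
  · subst h
    exact ⟨hη, by norm_num⟩
  · have hρ' : 0 < ρ := lt_of_le_of_ne hρ (Ne.symm h)
    have hq : (1 - ρ ^ 2) ^ 4 ≤ 1 := pow_le_one₀ (by nlinarith) (by nlinarith)
    obtain ⟨h1, h2⟩ := le_min_iff.1 hη
    refine ⟨le_min h1 (h2.trans (by gcongr)), ?_⟩
    rw [le_div_iff₀ (by positivity)] at h2
    linarith

end Parameters

/-! ### The rate at the random index. -/

section UniformRate

variable {d n : ℕ} {Ξ : Fin n → Type*} [∀ i, MeasurableSpace (Ξ i)] {Ω : Type*}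
  {mΩ : MeasurableSpace Ω} {F : ∀ i, Vec d → Ξ i → ℝ} {r : Vec d → EReal}
  {W : Matrix (Fin n) (Fin n) ℝ} {D : ∀ i, Measure (Ξ i)} {μ : Measure Ω}
  [IsProbabilityMeasure μ] {ξ : ∀ i, ℕ → Ω → Ξ i} {C : Set (Vec d)} {h f : Vec d → ℝ}
  {G : Fin n → Vec d → Vec d} {L lam η : ℝ} {P : Vec d → Vec d} {σ : ℝ} {x0 : Vec d}

/-- The squared stationarity and consensus measure of a state. -/
noncomputable def stationarity (lam η : ℝ) (P : Vec d → Vec d) (s : State d n) : ℝ :=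
  1 / lam ^ 2 * frobSq (fun i => s.x i - P (s.x i)) + 4 / (lam * η) * frobSq (perp s.x)

theorem SampledProblem.rate (S : SampledProblem F r W D μ ξ C h f G L lam η P σ) (hx0 : x0 ∈ C)
    {T : ℕ} (hT : 0 < T) {b : ℝ} (hb : ∀ x, b ≤ proxValue (fun x => f x + h x) lam P x)
    (h1 : specNorm (W - avgMat n) * η * L ≤ (1 - specNorm (W - avgMat n) ^ 2) ^ 4 / 96)
    (h2 : specNorm (W - avgMat n) * lam * L ≤ 1 / 96)
    {τ : Ω → Fin T} (hτ : Measurable τ) (hunif : ∀ t : Fin T, μ (τ ⁻¹' {t}) = (T : ENNReal)⁻¹)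
    (hindep : IndepFun τ (fun ω i t => ξ i t ω) μ) :
    Integrable (fun ω => stationarity lam η P (state F r W η x0 ξ (τ ω) ω)) μ ∧
    1 / (n : ℝ) * ∫ ω, stationarity lam η P (state F r W η x0 ξ (τ ω) ω) ∂μ
      ≤ 8 * (proxValue (fun x => f x + h x) lam P x0 - b) / (η * T)
        + 4616 * η / (lam * (1 - specNorm (W - avgMat n) ^ 2) ^ 3) * σ ^ 2
        + 768 * η * (∫ ω, frobSq (perp fun i => stochGrad F i x0 (ξ i 0 ω)) ∂μ)
          / (n * lam * T * (1 - specNorm (W - avgMat n) ^ 2) ^ 3) := by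
  -- All states are measurable for the σ-algebra of the whole sample path, of which `τ` is
  -- independent.
  have hle : MeasurableSpace.comap (fun ω i t => ξ i t ω) inferInstance ≤ mΩ :=
    (measurable_pi_lambda _ fun i => measurable_pi_lambda _ fun t =>
      S.sample_measurable i t).comap_le
  have hmeas : ∀ j u,
      Measurable[MeasurableSpace.comap (fun ω i t => ξ i t ω) inferInstance] (ξ j u) := fun j u =>
    (show Measurable fun s : ∀ i, ℕ → Ξ i => s j u by fun_prop).comp (comap_measurable _)
  have hx := fun t i => (S.state_sqIntegrable hx0 t _ hle (fun j u _ => hmeas j u) i).1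
  have hres := fun t i => S.residual_sqIntegrable hle (hx t i)
  have hperp := fun t i => SqIntegrable.perp (hx t) i
  have hi1 := fun t => SqIntegrable.integrable_frobSq (hres t)
  have hi2 := fun t => SqIntegrable.integrable_frobSq (hperp t)
  obtain ⟨hint, heq⟩ := integral_uniform_index hτ hunif ((IndepFun_iff_Indep _ _ _).1 hindep)
    (g := fun t ω => stationarity lam η P (state F r W η x0 ξ t ω))
    (fun t => ((SqIntegrable.measurable_frobSq (hres t)).const_mul _).add
      ((SqIntegrable.measurable_frobSq (hperp t)).const_mul _))
    (fun t => ((hi1 t).const_mul _).add ((hi2 t).const_mul _))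
  refine ⟨hint, ?_⟩
  have hsum := S.sum_integral_le hx0 T hb h1 h2
  have hst : ∀ t, ∫ ω, stationarity lam η P (state F r W η x0 ξ t ω) ∂μ = 1 / lam ^ 2 *
        (∫ ω, ∑ i, ‖(state F r W η x0 ξ t ω).x i - P ((state F r W η x0 ξ t ω).x i)‖ ^ 2 ∂μ)
        + 4 / (lam * η) * ∫ ω, frobSq (perp (state F r W η x0 ξ t ω).x) ∂μ := by
    intro t
    simp only [stationarity]
    rw [integral_add ((hi1 t).const_mul _) ((hi2 t).const_mul _), integral_const_mul,
      integral_const_mul]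
    rfl
  rw [heq, Finset.sum_congr rfl fun t _ => hst t]
  have hn : (0 : ℝ) < n := by exact_mod_cast S.pos
  have hT' : (0 : ℝ) < T := by exact_mod_cast hT
  have hη := S.eta_pos
  have hlam := S.lam_pos
  have hq : 0 < 1 - specNorm (W - avgMat n) ^ 2 := by
    have h0 : 0 ≤ specNorm (W - avgMat n) := norm_nonneg _
    nlinarith [S.spectral]
  calc _ = 1 / (n * T : ℝ) * _ := by rw [← mul_assoc, one_div_mul_one_div]
    _ ≤ 1 / (n * T : ℝ) * _ := mul_le_mul_of_nonneg_left hsum (by positivity)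
    _ = _ := by field_simp

end UniformRate

/-! ### Lower bounds and smoothness of the objective. -/

section Objective

variable {d n : ℕ} {C : Set (Vec d)} {h : Vec d → ℝ}

/-- Supplies the existence of the proximal points of `r`: from `h ≥ m - f` and the quadratic upper
model of `f`, `h` falls at most quadratically, with a curvature dominated by `1 / (2 * η) ≥ 2 * L`.
-/
lemma exists_lower_bound_of_smooth {E : Type*} [NormedAddCommGroup E] [InnerProductSpace ℝ E]
    {C : Set E} {f h : E → ℝ} {L η m : ℝ} {x0 g : E} (hL : 0 < L) (hη : 0 < η)
    (hηL : η ≤ 1 / (4 * L)) (hm : ∀ z ∈ C, m ≤ f z + h z)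
    (hf : ∀ z ∈ C, f z ≤ f x0 + inner ℝ g (z - x0) + L / 2 * ‖z - x0‖ ^ 2) (x : E) :
    ∃ b, ∀ z ∈ C, b ≤ h z + 1 / (2 * η) * ‖z - x‖ ^ 2 := by
  refine ⟨m - f x0 - ‖g‖ ^ 2 / (2 * L) - 2 * L * ‖x0 - x‖ ^ 2, fun z hz => ?_⟩
  have a := hm z hz
  have b := hf z hz
  have c := real_inner_le_norm g (z - x0)
  have e : 2 * L ≤ 1 / (2 * η) := by
    rw [le_div_iff₀ (by positivity)] at hηL ⊢
    linarith
  have e' := mul_le_mul_of_nonneg_right e (sq_nonneg ‖z - x‖)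
  have t : ‖z - x0‖ ^ 2 ≤ 2 * ‖z - x‖ ^ 2 + 2 * ‖x0 - x‖ ^ 2 := by
    have h1 : ‖z - x0‖ ≤ ‖z - x‖ + ‖x0 - x‖ := by
      rw [norm_sub_rev x0 x]; exact norm_sub_le_norm_sub_add_norm_sub z x x0
    nlinarith [norm_nonneg (z - x0), sq_nonneg (‖z - x‖ - ‖x0 - x‖)]
  have t' := mul_le_mul_of_nonneg_left t hL.le
  have s : ‖g‖ * ‖z - x0‖ ≤ ‖g‖ ^ 2 / (2 * L) + L / 2 * ‖z - x0‖ ^ 2 := by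
    have h1 : ‖g‖ ^ 2 / (2 * L) + L / 2 * ‖z - x0‖ ^ 2 - ‖g‖ * ‖z - x0‖
        = (‖g‖ - L * ‖z - x0‖) ^ 2 / (2 * L) := by field_simp; ring
    have h2 : 0 ≤ (‖g‖ - L * ‖z - x0‖) ^ 2 / (2 * L) := by positivity
    linarith
  linarith

lemma abs_average_sub_linearization_le (hn : 0 < n) {f : Fin n → Vec d → ℝ} {L : ℝ}
    (hC : Convex ℝ C) (hd : ∀ i, ∀ x ∈ C, DifferentiableAt ℝ (f i) x)
    (hL : ∀ i, ∀ x ∈ C, ∀ y ∈ C, ‖gradient (f i) x - gradient (f i) y‖ ≤ L * ‖x - y‖)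
    {x y : Vec d} (hx : x ∈ C) (hy : y ∈ C) :
    |(1 / (n : ℝ) * ∑ i, f i y) - (1 / (n : ℝ) * ∑ i, f i x)
      - inner ℝ (avgCol fun i => gradient (f i) x) (y - x)| ≤ L / 2 * ‖y - x‖ ^ 2 := by
  have hn' : (0 : ℝ) < n := by exact_mod_cast hn
  have e : (1 / (n : ℝ) * ∑ i, f i y) - (1 / (n : ℝ) * ∑ i, f i x)
      - inner ℝ (avgCol fun i => gradient (f i) x) (y - x)
      = 1 / (n : ℝ) * ∑ i, (f i y - f i x - inner ℝ (gradient (f i) x) (y - x)) := by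
    rw [avgCol, inner_smul_left, sum_inner, Finset.sum_sub_distrib, Finset.sum_sub_distrib]
    simp only [conj_trivial]
    ring
  rw [e, abs_mul, abs_of_pos (by positivity : 0 < 1 / (n : ℝ))]
  calc _ ≤ 1 / (n : ℝ) * ∑ i : Fin n, L / 2 * ‖y - x‖ ^ 2 := by
        gcongr
        exact (Finset.abs_sum_le_sum_abs _ _).trans (Finset.sum_le_sum fun i _ =>
          abs_sub_linearization_le hC (hd i) (hL i) hx hy)
    _ = _ := by
        rw [Finset.sum_const, Finset.card_univ, Fintype.card_fin, nsmul_eq_mul]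
        field_simp

lemma Represents.objective {r : Vec d → EReal} (H : Represents r C h) (f : Fin n → Vec d → ℝ) :
    Represents (objective f r) C fun x => 1 / (n : ℝ) * ∑ i, f i x + h x where
  eq_coe x hx := by rw [DProxSGT.objective, H.eq_coe x hx, ← EReal.coe_add]
  eq_top x hx := by rw [DProxSGT.objective, H.eq_top x hx, EReal.coe_add_top]

end Objective

end DProxSGT

/-! ### Assembly of the main theorem. -/

theorem mainTheorem1
    {d n : ℕ} (hn : 0 < n)
    -- sample spaces, data distributions, sample losses, regularizer
    {Ξ : Fin n → Type*} [∀ i, MeasurableSpace (Ξ i)]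
    (D : ∀ i, Measure (Ξ i)) [∀ i, IsProbabilityMeasure (D i)]
    (F : ∀ i, DProxSGT.Vec d → Ξ i → ℝ) (r : DProxSGT.Vec d → EReal)
    (f : Fin n → DProxSGT.Vec d → ℝ) (hf : f = DProxSGT.localLoss F D)
    (φ : DProxSGT.Vec d → EReal) (hφ : φ = DProxSGT.objective f r)
    -- the losses are well defined near dom r, and the stochastic gradients exist on dom r
    (hF_int : ∀ i, ∀ x ∈ DProxSGT.effDom r, ∀ᶠ z in nhds x, Integrable (F i z) (D i))
    (hF_diff : ∀ i, ∀ x ∈ DProxSGT.effDom r, ∀ᵐ s ∂(D i), DifferentiableAt ℝ (fun z => F i z s) x)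
    (hF_meas : ∀ i, Measurable fun p : DProxSGT.effDom r × Ξ i =>
      DProxSGT.stochGrad F i (p.1 : DProxSGT.Vec d) p.2)
    -- problem structure
    (hr : DProxSGT.IsClosedConvex r)
    (L : ℝ) (hL : 0 < L)
    (hf_diff : ∀ i, ∀ x ∈ DProxSGT.effDom r, DifferentiableAt ℝ (f i) x)
    (hf_smooth : ∀ i, ∀ x ∈ DProxSGT.effDom r, ∀ y ∈ DProxSGT.effDom r,
      ‖gradient (f i) x - gradient (f i) y‖ ≤ L * ‖x - y‖)
    (hφ_bdd : ∃ m : ℝ, ∀ x, (m : EReal) ≤ φ x)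
    -- mixing matrix
    (W : Matrix (Fin n) (Fin n) ℝ) (hW : W ∈ doublyStochastic ℝ (Fin n))
    (ρ : ℝ) (hρ : ρ = DProxSGT.specNorm (W - DProxSGT.avgMat n)) (hρ1 : ρ < 1)
    -- stochastic gradients are unbiased with variance at most σ²
    (σ : ℝ) (hσ : 0 ≤ σ)
    (h_unbiased : ∀ i, ∀ x ∈ DProxSGT.effDom r,
      Integrable (DProxSGT.stochGrad F i x) (D i) ∧
        ∫ s, DProxSGT.stochGrad F i x s ∂(D i) = gradient (f i) x)
    (h_var : ∀ i, ∀ x ∈ DProxSGT.effDom r,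
      Integrable (fun s => ‖DProxSGT.stochGrad F i x s - gradient (f i) x‖ ^ 2) (D i) ∧
        ∫ s, ‖DProxSGT.stochGrad F i x s - gradient (f i) x‖ ^ 2 ∂(D i) ≤ σ ^ 2)
    -- independent samples
    {Ω : Type*} [MeasurableSpace Ω] (μ : Measure Ω) [IsProbabilityMeasure μ]
    (ξ : ∀ i, ℕ → Ω → Ξ i) (hξ_meas : ∀ i t, Measurable (ξ i t))
    (hξ_law : ∀ i t, μ.map (ξ i t) = D i)
    (hξ_indep : iIndepFun (fun p : Fin n × ℕ => ξ p.1 p.2) μ)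
    -- starting point, number of iterations, parameters
    (x0 : DProxSGT.Vec d) (hx0 : x0 ∈ DProxSGT.effDom r)
    (T : ℕ) (hT : 0 < T)
    (lam : ℝ) (hlam : lam = DProxSGT.lamChoice L ρ)
    (η : ℝ) (hη0 : 0 < η) (hη : η ≤ DProxSGT.etaMax L ρ)
    -- the random index, uniform on {0, …, T-1} and independent of the samples
    (τ : Ω → Fin T) (hτ_meas : Measurable τ)
    (hτ_unif : ∀ t : Fin T, μ (τ ⁻¹' {t}) = (T : ENNReal)⁻¹)
    (hτ_indep : IndepFun τ (fun ω i t => ξ i t ω) μ)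
    -- the iterates, as random matrices
    (X : ℕ → Ω → DProxSGT.Cols d n)
    (hX : X = fun t ω => DProxSGT.iterate F r W η x0 (fun i t => ξ i t ω) t) :
    -- the Moreau envelope is finite, differentiable and bounded below,
    -- and it attains its infimum if the objective does
    (∀ x, ((DProxSGT.moreau φ lam x : ℝ) : EReal) = DProxSGT.moreauE φ lam x) ∧
    Differentiable ℝ (DProxSGT.moreau φ lam) ∧
    BddBelow (Set.range (DProxSGT.moreau φ lam)) ∧
    ((∃ z, ∀ y, φ z ≤ φ y) → ∃ z, ∀ y, DProxSGT.moreau φ lam z ≤ DProxSGT.moreau φ lam y) ∧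
    -- the convergence rate
    Integrable (fun ω => ∑ i, ‖gradient (DProxSGT.moreau φ lam) (X (τ ω) ω i)‖ ^ 2
        + 4 / (lam * η) * DProxSGT.frobSq (DProxSGT.perp (X (τ ω) ω))) μ ∧
    1 / (n : ℝ) * ∫ ω, (∑ i, ‖gradient (DProxSGT.moreau φ lam) (X (τ ω) ω i)‖ ^ 2
        + 4 / (lam * η) * DProxSGT.frobSq (DProxSGT.perp (X (τ ω) ω))) ∂μ
      ≤ 8 * (DProxSGT.moreau φ lam x0 - ⨅ x, DProxSGT.moreau φ lam x) / (η * T)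
        + 4616 * η / (lam * (1 - ρ ^ 2) ^ 3) * σ ^ 2
        + 768 * η * (∫ ω, DProxSGT.frobSq (DProxSGT.perp
              (fun i => DProxSGT.stochGrad F i x0 (ξ i 0 ω))) ∂μ)
            / (n * lam * T * (1 - ρ ^ 2) ^ 3) := by
  subst hρ
  have hρ0 : 0 ≤ DProxSGT.specNorm (W - DProxSGT.avgMat n) := norm_nonneg _
  obtain ⟨hlam0, hlamL, hlamρ⟩ := DProxSGT.lamChoice_spec hL hρ0
  obtain ⟨hηlam, hηρ⟩ := DProxSGT.etaMax_spec hL hρ0 hρ1 hη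
  rw [← hlam] at hlam0 hlamL hlamρ hηlam
  set C := DProxSGT.effDom r with hC
  set h : DProxSGT.Vec d → ℝ := fun x => (r x).toReal with hh
  set fbar : DProxSGT.Vec d → ℝ := fun x => 1 / (n : ℝ) * ∑ i, f i x with hfbar
  have hne : C.Nonempty := ⟨x0, hx0⟩
  have hrep := hr.represents
  have hrepφ : DProxSGT.Represents φ C (fun x => fbar x + h x) := hφ ▸ hrep.objective f
  have hconv : DProxSGT.IsWeaklyConvexClosed C h 0 := hr.isWeaklyConvexClosed hne
  have hquad : ∀ x ∈ C, ∀ y ∈ C, |fbar y - fbar x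
      - inner ℝ (DProxSGT.avgCol fun i => gradient (f i) x) (y - x)| ≤ L / 2 * ‖y - x‖ ^ 2 :=
    fun x hx y hy => DProxSGT.abs_average_sub_linearization_le hn hconv.convex hf_diff hf_smooth
      hx hy
  have hcont : ∀ x ∈ C, ContinuousAt fbar x := fun x hx =>
    (tendsto_finsetSum _ fun i _ => (hf_diff i x hx).continuousAt).const_mul _
  have hweak : DProxSGT.IsWeaklyConvexClosed C (fun x => fbar x + h x) L :=
    hconv.add_smooth hcont hquad
  obtain ⟨b, hb⟩ := hφ_bdd
  have hbC : ∀ z ∈ C, b ≤ fbar z + h z := fun z hz => by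
    have := hb z
    rw [hrepφ.eq_coe z hz] at this
    exact_mod_cast this
  have hexφ : ∀ x, ∃ p, DProxSGT.IsProx C (fun x => fbar x + h x) lam x p := fun x =>
    hweak.exists_isProx (by linarith) hlam0 x ⟨b, fun z hz => by
      have : 0 ≤ 1 / (2 * lam) * ‖z - x‖ ^ 2 := by positivity
      linarith [hbC z hz]⟩
  choose P hP using hexφ
  have hexr : ∀ x, ∃ p, DProxSGT.IsProx C h η x p := fun x =>
    hconv.exists_isProx (by simp) hη0 x (DProxSGT.exists_lower_bound_of_smooth (x0 := x0)
      (g := DProxSGT.avgCol fun i => gradient (f i) x0) hL hη0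
      (by rw [le_div_iff₀ (by positivity)]
          linarith [mul_le_mul_of_nonneg_right hηlam hL.le]) hbC
      (fun z hz => by linarith [(abs_le.1 (hquad x0 hx0 z hz)).2]) x)
  have S : DProxSGT.SampledProblem F r W D μ ξ C h fbar (fun i => gradient (f i)) L lam η P σ :=
    { pos := hn
      convex := hconv
      weaklyConvex := hweak
      quadratic := hquad
      lipschitz := hf_smooth
      isProx := hP
      exists_prox := hexr
      L_nonneg := hL.le
      lam_pos := hlam0
      lam_mul_le := hlamL
      eta_pos := hη0
      eta_le := hηlam
      prox_r := fun x => hrep.isProx_prox hne (hexr x)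
      mixing := hW
      spectral := hρ1
      prob := inferInstance
      grad_measurable := hF_meas
      unbiased := h_unbiased
      variance := h_var
      sample_measurable := hξ_meas
      sample_law := hξ_law
      sample_indep := hξ_indep }
  have hval := hrepφ.moreau_eq hne hP
  have hgrad : ∀ x, HasGradientAt (DProxSGT.moreau φ lam) ((1 / lam) • (x - P x)) x := fun x =>
    hval ▸ DProxSGT.hasGradientAt_proxValue hweak hlam0 (by linarith) hP x
  have hlow : ∀ x, b ≤ DProxSGT.moreau φ lam x := fun x => by
    have h1 := hbC _ (hP x).1
    have h2 : 0 ≤ 1 / (2 * lam) * ‖P x - x‖ ^ 2 := by positivity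
    rw [hval, DProxSGT.proxValue]
    linarith
  have hbdd : BddBelow (Set.range (DProxSGT.moreau φ lam)) :=
    ⟨b, by rintro _ ⟨x, rfl⟩; exact hlow x⟩
  refine ⟨fun x => by rw [hval, hrepφ.moreauE_eq hne hP],
    fun x => (hgrad x).differentiableAt, hbdd, ?_, ?_⟩
  · rintro ⟨z, hz⟩
    have hzC : z ∈ C := by
      by_contra hzC
      have := hz x0
      rw [hrepφ.eq_top z hzC, hrepφ.eq_coe x0 hx0, top_le_iff] at this
      exact EReal.coe_ne_top _ this
    -- A minimizer `z` of `φ` also minimizes the envelope: the envelope at `z` is at most `φ z`,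
    -- hence at most `φ (P y)`, hence at most the envelope at `y`.
    refine ⟨z, fun y => ?_⟩
    have h1 := (hP z).2 z hzC
    have h2 := hz (P y)
    rw [hrepφ.eq_coe z hzC, hrepφ.eq_coe _ (hP y).1] at h2
    have h3 : fbar z + h z ≤ fbar (P y) + h (P y) := by exact_mod_cast h2
    have h4 : 0 ≤ 1 / (2 * lam) * ‖P y - y‖ ^ 2 := by positivity
    rw [sub_self, norm_zero] at h1
    rw [hval, DProxSGT.proxValue, DProxSGT.proxValue]
    linarith
  -- the expected stationarity measure at a fixed iteration
  have hsq : ∀ x, ‖gradient (DProxSGT.moreau φ lam) x‖ ^ 2 = 1 / lam ^ 2 * ‖x - P x‖ ^ 2 := by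
    intro x
    rw [(hgrad x).gradient, norm_smul, Real.norm_of_nonneg (by positivity), mul_pow, div_pow,
      one_pow]
  have hXst : ∀ t ω, X t ω = (DProxSGT.state F r W η x0 ξ t ω).x := fun t ω => by rw [hX]; rfl
  have hstat : (fun ω => ∑ i, ‖gradient (DProxSGT.moreau φ lam) (X (τ ω) ω i)‖ ^ 2
        + 4 / (lam * η) * DProxSGT.frobSq (DProxSGT.perp (X (τ ω) ω)))
      = fun ω => DProxSGT.stationarity lam η P (DProxSGT.state F r W η x0 ξ (τ ω) ω) := by
    funext ω
    simp only [hsq, hXst, DProxSGT.stationarity, DProxSGT.frobSq, Finset.mul_sum]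
  -- The lower bound passed to `rate` is the infimum of the envelope itself, not the bound `b` on
  -- `φ`.
  have hlow' : ∀ x, ⨅ x, DProxSGT.moreau φ lam x
      ≤ DProxSGT.proxValue (fun x => fbar x + h x) lam P x := fun x => by
    rw [← hval]; exact ciInf_le hbdd x
  have hrate := S.rate hx0 hT hlow' hηρ hlamρ hτ_meas hτ_unif hτ_indep
  rw [← hval] at hrate
  rw [hstat]
  exact hrate
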